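/- **Proposition (pedal surface of a conic).** Let $c\subset\mathbb R^3$ be an ellipse (possibly a circle), a hyperbola or a parabola, in arbitrary position, and let $O$ be the origin. Let $F^\star$ be the set of all planes of $\mathbb R^3$ that contain a tangent line of the projective closure of $c$ (so planes through an asymptote of a hyperbola, and planes parallel to the carrier plane of a parabola, are included). The *pedal surface* of a set of planes is the set of the feet of the perpendiculars from $O$ to these planes; let $G$ be the pedal surface of $F^\star$. A *Darboux cyclide* is a surface that is the zero set of a quadratic form $\mathbf y^T B\,\mathbf y$ in the pentaspherical coordinates $\mathbf y=\left(\tfrac{|x|^2+1}{2},x_1,x_2,x_3,\tfrac{|x|^2-1}{2}\right)$. A *canal surface* is the envelope of a smooth one-parameter family of spheres, where planes are counted as spheres and limiting point spheres are allowed; a *Dupin cyclide* is a surface that is such an envelope in a twofold way, i.e. for two families without common sphere. The *conchoid surface* of $G$ at distance $d$ is the closure of the set of all points $Q$ that lie on a line $OP$, with $P\in G\setminus\{O\}$, at distance $|d|$ from $P$. Then: 1. $F^\star$ is a singular dual quadric: there is a symmetric matrix $A\in\mathbb R^{4\times4}$ of rank $3$ such that a plane $u_0+u_1x_1+u_2x_2+u_3x_3=0$,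 $(u_1,u_2,u_3)\ne 0$, belongs to $F^\star$ if and only if $U^TAU=0$ for $U=(u_0,u_1,u_2,u_3)^T$. 2. The pedal surface $G$ is a Darboux cyclide, and it is also a canal surface. 3. Let $d\neq 0$, and let $F_d^\star$ consist of the tangent planes (and their limit planes) of the pipe surface of radius $|d|$ with centre curve $c$, i.e. of the envelope of the spheres of radius $|d|$ centred on $c$. Then $F_d^\star$ is the offset of $F^\star$, that is, it consists of the planes $n\cdot x=e\pm d$ for all planes $n\cdot x=e$ in $F^\star$ with $|n|=1$; and the pedal surface of $F_d^\star$ is the conchoid surface of $G$ at distance $d$ with respect to $O$. 4. If $O$ lies on the focal conic of $c$, then $G$ is a Dupin cyclide. Here the focal conic lies in the plane through the principal axis of $c$ orthogonal to the plane of $c$, and is given, in Cartesian coordinates $(x,y,z)$ in which $c$ lies in $z=0$ and has its normal form, by $y=0$ and: $b^2x^2-(a^2-b^2)z^2=b^2(a^2-b^2)$ for the ellipse $x^2/a^2+y^2/b^2=1$, $a\ge b>0$ (for a circle this is its axis of rotation); $x^2/(a^2+b^2)+z^2/b^2=1$ for the hyperbola $x^2/a^2-y^2/b^2=1$, $a,b>0$;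 $z^2=-2p(x-p/2)$ for the parabola $y^2=2px$, $p>0$. -/

import Mathlib

open scoped ContDiff RealInnerProductSpace

noncomputable section

/-- Euclidean three-space; the reference point `O` is its origin `0`. -/
abbrev E3 : Type := EuclideanSpace ℝ (Fin 3)

/-! ### Planes, foot points, offsets of dual surfaces, conchoids

A pair `(n, e)` with `n ≠ 0` stands for the plane `⟪n, x⟫ = e`; a dual surface is a set of such
pairs. -/

/-- The foot point of the perpendicular from `O` to the plane `⟪n, x⟫ = e`. -/
def footPoint (E : E3 × ℝ) : E3 := (E.2 / ‖E.1‖ ^ 2) • E.1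

/-- The pedal surface of a dual surface: the foot points on all its planes. -/
def pedal (F : Set (E3 × ℝ)) : Set E3 := footPoint '' {E ∈ F | E.1 ≠ 0}

/-- The offset at distance `d` of a dual surface: each plane `⟪n, x⟫ = e`, written with a unit
normal vector `n`, is moved to `⟪n, x⟫ = e + d`. Both unit normals of a (non-oriented) plane are used,
so that this is the two-sided offset, consisting of the planes `⟪n, x⟫ = e ± d`. -/
def offsetPlanes (d : ℝ) (F : Set (E3 × ℝ)) : Set (E3 × ℝ) :=
  {E | ‖E.1‖ = 1 ∧ ((E.1, E.2 - d) ∈ F ∨ (E.1, E.2 + d) ∈ F)}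

/-- The conchoid surface of `G` at distance `d` with respect to `O`: the closure of the set of all
points `Q` on lines `OP`, with `P ∈ G`, at distance `|d|` from `P`. -/
def conchoid (d : ℝ) (G : Set E3) : Set E3 :=
  closure {Q | ∃ P ∈ G, P ≠ 0 ∧ Q ∈ line[ℝ, (0 : E3), P] ∧ dist Q P = |d|}

/-! ### Darboux cyclides -/

/-- Pentaspherical coordinates of a point: the inverse of the stereographic projection
`x₀ = y₀ - y₄`, `xᵢ = yᵢ` of `y₀² = y₁² + y₂² + y₃² + y₄²`, normalized by `x₀ = 1`. -/
def pentaspherical (x : E3) : Fin 5 → ℝ :=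
  ![(‖x‖ ^ 2 + 1) / 2, x 0, x 1, x 2, (‖x‖ ^ 2 - 1) / 2]

/-- A Darboux cyclide: the zero set of a quadratic form in pentaspherical coordinates that is a
surface, i.e. has a point where the gradient of its equation does not vanish. -/
def IsDarbouxCyclide (G : Set E3) : Prop :=
  ∃ B : Matrix (Fin 5) (Fin 5) ℝ, B.IsSymm ∧
    G = {x | pentaspherical x ⬝ᵥ B.mulVec (pentaspherical x) = 0} ∧
    ∃ x ∈ G, fderiv ℝ (fun z : E3 => pentaspherical z ⬝ᵥ B.mulVec (pentaspherical z)) x ≠ 0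

/-! ### Envelopes of spheres -/

/-- The equation `a ‖x‖² + ⟪b, x⟫ + k` of the sphere (a plane if `a = 0`) with coefficients
`(a, b, k)`. Proportional coefficients describe the same sphere. -/
def sphereEq (s : ℝ × E3 × ℝ) (x : E3) : ℝ := s.1 * ‖x‖ ^ 2 + ⟪s.2.1, x⟫ + s.2.2

/-- The characteristic of the family `s` at `t`: the points of the sphere `s t` at which the
derivative of the equation with respect to the parameter vanishes as well. -/
def characteristic (s : ℝ → ℝ × E3 × ℝ) (t : ℝ) : Set E3 :=
  {x | sphereEq (s t) x = 0 ∧ sphereEq (deriv s t) x = 0}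

/-- `G` is the envelope of the smooth one-parameter family `s` of spheres, planes being counted as
spheres. The family is a regular curve in the projective space of spheres. For a dense set of
parameters the characteristic has more than one point; as an intersection of two different spheres
or planes it is then a circle or a line and `s t` is a real sphere of positive radius or a plane.
In the limit, `s t` may be a point sphere or touch its characteristic in a point only. -/
structure IsSphereEnvelope (s : ℝ → ℝ × E3 × ℝ) (G : Set E3) : Prop where
  smooth : ContDiff ℝ ∞ s
  regular : ∀ t, LinearIndependent ℝ ![s t, deriv s t]
  circles : Dense {t | (characteristic s t).Nontrivial}
  envelope : G = ⋃ t, characteristic s t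

/-- A canal surface: the envelope of a one-parameter family of spheres. -/
def IsCanalSurface (G : Set E3) : Prop := ∃ s, IsSphereEnvelope s G

/-- A Dupin cyclide: the envelope of one-parameter families of spheres in a twofold way. The two
families have no sphere in common. -/
def IsDupinCyclide (G : Set E3) : Prop :=
  ∃ s₁ s₂, IsSphereEnvelope s₁ G ∧ IsSphereEnvelope s₂ G ∧
    ∀ t u, LinearIndependent ℝ ![s₁ t, s₂ u]

/-! ### Conics -/

/-- The shape and size of a (regular, real) conic, in Euclidean normal form:
`x²/a² + y²/b² = 1` (a circle if `a = b`), `x²/a² - y²/b² = 1`, or `y² = 2 p x`. -/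
inductive ConicShape : Type
  | ellipse (a b : ℝ) (hb : 0 < b) (hab : b ≤ a)
  | hyperbola (a b : ℝ) (ha : 0 < a) (hb : 0 < b)
  | parabola (p : ℝ) (hp : 0 < p)

/-- The symmetric matrix of the homogeneous equation of the conic, in the order
`(w, x, y)` of coordinates, where `w = 0` is the line at infinity. -/
def ConicShape.matrix : ConicShape → Matrix (Fin 3) (Fin 3) ℝ
  | .ellipse a b _ _ => !![-1, 0, 0; 0, 1 / a ^ 2, 0; 0, 0, 1 / b ^ 2]
  | .hyperbola a b _ _ => !![-1, 0, 0; 0, 1 / a ^ 2, 0; 0, 0, -(1 / b ^ 2)]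
  | .parabola p _ => !![0, -p, 0; -p, 0, 0; 0, 0, 1]

/-- A conic in space: its normal form with respect to some Cartesian coordinate system
`(origin; frame 0, frame 1, frame 2)`. It lies in the plane through `origin` spanned by `frame 0`
and `frame 1`. -/
structure Conic where
  origin : E3
  frame : OrthonormalBasis (Fin 3) ℝ E3
  shape : ConicShape

namespace Conic

variable (c : Conic)

/-- The coordinates of a point in the coordinate system of the conic. -/
def coord (X : E3) (i : Fin 3) : ℝ := ⟪c.frame i, X - c.origin⟫

/-- The homogeneous coordinates `(1, x, y)` of (the orthogonal projection to the carrier plane of)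
a point. -/
def hom (X : E3) : Fin 3 → ℝ := ![1, c.coord X 0, c.coord X 1]

/-- The point set of the conic. -/
def points : Set E3 :=
  {X | c.coord X 2 = 0 ∧ c.hom X ⬝ᵥ c.shape.matrix.mulVec (c.hom X) = 0}

/-- The homogeneous line coordinates of the intersection of the plane `⟪n, x⟫ = e` with the
carrier plane of the conic (zero if the two planes coincide): the point `(w : x : y)` of the carrier
plane lies in the plane iff its dot product with this vector is zero. -/
def trace (n : E3) (e : ℝ) : Fin 3 → ℝ :=
  ![⟪n, c.origin⟫ - e, ⟪n, c.frame 0⟫, ⟪n, c.frame 1⟫]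

/-- The conic as a dual surface: all planes that contain the tangent line (the polar line) at some
point `v` of the projective closure of the conic. -/
def tangentPlanes : Set (E3 × ℝ) :=
  {E | E.1 ≠ 0 ∧ ∃ v : Fin 3 → ℝ, v ≠ 0 ∧ v ⬝ᵥ c.shape.matrix.mulVec v = 0 ∧
    ∀ w : Fin 3 → ℝ, w ⬝ᵥ c.shape.matrix.mulVec v = 0 → w ⬝ᵥ c.trace E.1 E.2 = 0}

/-- `u` is a direction vector of the tangent line of the conic at its point `X`, or zero. -/
def IsTangentVector (X u : E3) : Prop :=
  ∃ r s : ℝ, u = r • c.frame 0 + s • c.frame 1 ∧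
    ![0, r, s] ⬝ᵥ c.shape.matrix.mulVec (c.hom X) = 0

/-- The characteristic circle of the pipe surface of radius `|d|` on the sphere with centre `X`:
the great circle in the plane orthogonal to the conic at `X`. -/
def pipeCircle (d : ℝ) (X : E3) : Set E3 :=
  {Y | dist Y X = |d| ∧ ∀ u, c.IsTangentVector X u → ⟪u, Y - X⟫ = 0}

/-- The tangent planes, with both unit normal vectors, of the pipe surface of radius `|d|` around
the conic. The pipe surface is the envelope of the spheres of radius `|d|` centred on the conic, i.e.
the union of the circles `pipeCircle d X`; along such a circle its tangent planes are those of the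
sphere with centre `X`. -/
def pipeTangentPlanes (d : ℝ) : Set (E3 × ℝ) :=
  {E | ‖E.1‖ = 1 ∧ ∃ X ∈ c.points, ∃ Y ∈ c.pipeCircle d X,
    (∃ k : ℝ, Y - X = k • E.1) ∧ ⟪E.1, Y⟫ = E.2}

/-- The dual surface of the pipe surface: its tangent planes and their limits (tangent planes at
points at infinity). -/
def pipeDual (d : ℝ) : Set (E3 × ℝ) := closure (c.pipeTangentPlanes d)

/-- The focal conic: it lies in the plane through the axis `frame 0` of the conic that is orthogonal
to the carrier plane; its vertices are the foci of the conic, and its foci are the vertices of the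
conic on that axis. Normal forms: `x²/(a² - b²) - z²/b² = 1` for an ellipse (the axis of rotation for a
circle), `x²/(a² + b²) + z²/b² = 1` for a hyperbola, `z² = -2p (x - p/2)` for a parabola. -/
def focalConic : Set E3 :=
  {X | c.coord X 1 = 0 ∧
    match c.shape with
    | .ellipse a b _ _ =>
        b ^ 2 * c.coord X 0 ^ 2 - (a ^ 2 - b ^ 2) * c.coord X 2 ^ 2 = b ^ 2 * (a ^ 2 - b ^ 2)
    | .hyperbola a b _ _ => c.coord X 0 ^ 2 / (a ^ 2 + b ^ 2) + c.coord X 2 ^ 2 / b ^ 2 = 1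
    | .parabola p _ => c.coord X 2 ^ 2 = -(2 * p) * (c.coord X 0 - p / 2)}

end Conic

end

/-! The linear map `ConicShape.param` carries the cone z₁² + z₂² = z₀² onto the cone over the conic.
Its transpose turns plane coordinates (n, e) linearly into `coneTrace n e`, and since the cone is
self-dual up to the sign of z₀, a plane is tangent exactly when its `coneTrace` lies on the cone
(`mem_tangentPlanes_iff`). The linear map has rank 3, whence the singular dual quadric.

A point x ≠ 0 is the foot of exactly one plane, (x, ‖x‖²), so G is given by `OnCone (coneTrace x
‖x‖²)` (`mem_pedal_tangentPlanes_iff`). The three components are equations of spheres through O, so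
G has the form S₁² + S₂² = S₀². This is quadratic in pentaspherical coordinates, and it is the
envelope of S₀ + cos t S₁ + sin t S₂: the spheres whose diameters join O to the points of the conic
(planes for points at infinity).

A tangent plane of the pipe surface is a tangent plane of the conic, touching at a proper point,
moved by ±d. Contact points at infinity come in as limits, because a nonzero linear form is nonzero
on a dense part of the cone. For a unit normal n the foot is e • n, so moving e slides the foot
along its line through O. The planes through O, which the conchoid construction omits, are limits as
well.

With R = ‖x‖², eliminating the `frame 1` coordinate brings the equation of G to the form q = R T,
where T is a sphere or plane and q is a quadratic form in the coordinates along `frame 0` and `frame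
2`. The discriminant of q vanishes when O lies on the focal conic, and then q = l². Now (2l)² + (R -
T)² = (R + T)² is a second cone of spheres and gives the second family
(`isDupinCyclide_pedal_of_factorization`). -/

noncomputable section

/-! ### The cone `z₁² + z₂² = z₀²` -/

/-- The points of the quadratic cone `z₁² + z₂² = z₀²`. -/
def OnCone (z : Fin 3 → ℝ) : Prop := z 1 ^ 2 + z 2 ^ 2 = z 0 ^ 2

/-- The generator of the cone at the angle `t`. -/
def coneRay (t : ℝ) : Fin 3 → ℝ := ![-1, Real.cos t, Real.sin t]

theorem onCone_smul_coneRay (m t : ℝ) : OnCone (m • coneRay t) := by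
  have := Real.sin_sq_add_cos_sq t
  simp only [OnCone, coneRay, Pi.smul_apply, smul_eq_mul, Matrix.cons_val]
  linear_combination m ^ 2 * this

theorem exists_cos_sin {x y : ℝ} (h : x ^ 2 + y ^ 2 = 1) :
    ∃ t, x = Real.cos t ∧ y = Real.sin t := by
  have h1 : ‖(⟨x, y⟩ : ℂ)‖ = 1 := by
    rw [Complex.norm_def, Complex.normSq_mk, Real.sqrt_eq_one]; linarith
  refine ⟨Complex.arg ⟨x, y⟩, ?_, ?_⟩
  · rw [Complex.cos_arg (by intro h0; simp [h0] at h1), h1]; simp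
  · rw [Complex.sin_arg, h1]; simp

theorem OnCone.exists_eq_smul_coneRay {z : Fin 3 → ℝ} (hz : OnCone z) :
    ∃ m t : ℝ, z = m • coneRay t := by
  unfold OnCone at hz
  by_cases h0 : z 0 = 0
  · refine ⟨0, 0, ?_⟩
    have h1 : z 1 = 0 := by nlinarith [sq_nonneg (z 1), sq_nonneg (z 2)]
    have h2 : z 2 = 0 := by nlinarith [sq_nonneg (z 1), sq_nonneg (z 2)]
    ext i; fin_cases i <;> simp [h0, h1, h2]
  · obtain ⟨t, hc, hs⟩ := exists_cos_sin (x := -(z 1 / z 0)) (y := -(z 2 / z 0)) (by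
      field_simp; linarith)
    refine ⟨-z 0, t, ?_⟩
    ext i
    fin_cases i <;> simp [coneRay, ← hc, ← hs] <;> field_simp

/-- A nonzero trigonometric polynomial of degree one is nonzero on a dense set. -/
theorem dense_trig_ne_zero {A B C : ℝ} (h : ¬(A = 0 ∧ B = 0 ∧ C = 0)) :
    Dense {t : ℝ | A + B * Real.cos t + C * Real.sin t ≠ 0} := by
  change Dense {t : ℝ | A + B * Real.cos t + C * Real.sin t = 0}ᶜ
  rw [← interior_eq_empty_iff_dense_compl]
  -- If the polynomial vanishes near t, so do its first two derivatives; the three values at t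
  -- determine A, B and C.
  by_contra hne
  obtain ⟨t, ht⟩ := Set.nonempty_iff_ne_empty.mpr hne
  have e0 : (fun t : ℝ => A + B * Real.cos t + C * Real.sin t) =ᶠ[nhds t] fun _ => 0 :=
    mem_interior_iff_mem_nhds.mp ht
  have d0 : deriv (fun t : ℝ => A + B * Real.cos t + C * Real.sin t) =
      fun t => -B * Real.sin t + C * Real.cos t := by
    ext x
    have h1 := (((Real.hasDerivAt_cos x).const_mul B).const_add A).add
      ((Real.hasDerivAt_sin x).const_mul C)
    exact (h1.congr_deriv (by ring)).deriv
  have e1 := e0.deriv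
  rw [d0] at e1
  have d1 : deriv (fun t : ℝ => -B * Real.sin t + C * Real.cos t) =
      fun t => -B * Real.cos t - C * Real.sin t := by
    ext x
    have h1 := ((Real.hasDerivAt_sin x).const_mul (-B)).add ((Real.hasDerivAt_cos x).const_mul C)
    exact (h1.congr_deriv (by ring)).deriv
  have e2 := e1.deriv
  rw [d1] at e2
  have q0 := e0.eq_of_nhds
  have q1 := e1.eq_of_nhds
  have q2 := e2.eq_of_nhds
  simp only [deriv_const'] at q0 q1 q2
  have := Real.sin_sq_add_cos_sq t
  refine h ⟨by linarith, ?_, ?_⟩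
  · linear_combination -B * this - Real.sin t * q1 - Real.cos t * q2
  · linear_combination -C * this + Real.cos t * q1 - Real.sin t * q2

theorem continuous_coneRay : Continuous coneRay := by
  unfold coneRay
  refine continuous_pi fun i => ?_
  fin_cases i <;> simp <;> fun_prop

theorem dense_dotProduct_coneRay_ne_zero {a : Fin 3 → ℝ} (ha : a ≠ 0) :
    Dense {t | a ⬝ᵥ coneRay t ≠ 0} := by
  have h := dense_trig_ne_zero (A := -a 0) (B := a 1) (C := a 2) (by
    rintro ⟨h0, h1, h2⟩
    apply ha
    ext i; fin_cases i <;> simp_all)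
  simpa [coneRay, dotProduct, Fin.sum_univ_three] using h

/-- A linear form that is not zero is nonzero on a dense subset of the cone. -/
theorem OnCone.mem_closure {a z : Fin 3 → ℝ} (ha : a ≠ 0) (hz : OnCone z) :
    z ∈ closure {z | OnCone z ∧ a ⬝ᵥ z ≠ 0} := by
  obtain ⟨m, t, rfl⟩ := hz.exists_eq_smul_coneRay
  -- In the parameters (m, t) of the cone the form is m times a trigonometric polynomial in t.
  have hd : Dense ({m : ℝ | m ≠ 0} ×ˢ {t | a ⬝ᵥ coneRay t ≠ 0}) :=
    (dense_compl_singleton (0 : ℝ)).prod (dense_dotProduct_coneRay_ne_zero ha)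
  have hc : Continuous fun p : ℝ × ℝ => p.1 • coneRay p.2 :=
    continuous_fst.smul (continuous_coneRay.comp continuous_snd)
  refine map_mem_closure (f := fun p : ℝ × ℝ => p.1 • coneRay p.2) hc (hd (m, t)) ?_
  rintro ⟨m', t'⟩ ⟨h1, h2⟩
  refine ⟨onCone_smul_coneRay _ _, ?_⟩
  rw [dotProduct_smul]
  exact mul_ne_zero h1 h2

/-! ### Envelopes described by cones -/

theorem sphereEq_add (s u : ℝ × E3 × ℝ) (x : E3) :
    sphereEq (s + u) x = sphereEq s x + sphereEq u x := by
  simp only [sphereEq, Prod.fst_add, Prod.snd_add, inner_add_left]; ring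

theorem sphereEq_smul (r : ℝ) (s : ℝ × E3 × ℝ) (x : E3) :
    sphereEq (r • s) x = r * sphereEq s x := by
  simp only [sphereEq, Prod.smul_fst, Prod.smul_snd, real_inner_smul_left, smul_eq_mul]; ring

/-- The one-parameter family of spheres `S₀ + cos t S₁ + sin t S₂`. -/
def circleFamily (S : Fin 3 → ℝ × E3 × ℝ) (t : ℝ) : ℝ × E3 × ℝ :=
  S 0 + Real.cos t • S 1 + Real.sin t • S 2

theorem hasDerivAt_circleFamily (S : Fin 3 → ℝ × E3 × ℝ) (t : ℝ) :
    HasDerivAt (circleFamily S) (-Real.sin t • S 1 + Real.cos t • S 2) t :=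
  (((Real.hasDerivAt_cos t).smul_const (S 1)).const_add (S 0)).add
    ((Real.hasDerivAt_sin t).smul_const (S 2))

/-- Equation and derivative are two independent linear conditions on the vector of the three sphere
values. Their solution line is spanned by `coneRay t`, whose entry -1 balances cos² + sin². -/
theorem mem_characteristic_circleFamily (S : Fin 3 → ℝ × E3 × ℝ) (t : ℝ) (x : E3) :
    x ∈ characteristic (circleFamily S) t ↔
      ∃ m : ℝ, (fun i => sphereEq (S i) x) = m • coneRay t := by
  have hsc := Real.sin_sq_add_cos_sq t
  simp only [characteristic, Set.mem_ofPred_eq, (hasDerivAt_circleFamily S t).deriv, circleFamily,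
    sphereEq_add, sphereEq_smul]
  constructor
  · rintro ⟨h1, h2⟩
    refine ⟨-sphereEq (S 0) x, ?_⟩
    ext i
    fin_cases i <;> simp [coneRay]
    · linear_combination Real.cos t * h1 - Real.sin t * h2 - sphereEq (S 1) x * hsc
    · linear_combination Real.sin t * h1 + Real.cos t * h2 - sphereEq (S 2) x * hsc
  · rintro ⟨m, hm⟩
    have h0 := congrFun hm 0
    have h1 := congrFun hm 1
    have h2 := congrFun hm 2
    simp [coneRay] at h0 h1 h2
    rw [h0, h1, h2]
    exact ⟨by linear_combination m * hsc, by ring⟩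

/-- The cone is the union of its generators, and each generator corresponds to one characteristic.
Reality of the circles is a separate matter and stays a hypothesis. -/
theorem isSphereEnvelope_circleFamily {S : Fin 3 → ℝ × E3 × ℝ} (hS : LinearIndependent ℝ S)
    {G : Set E3} (hG : G = {x | OnCone fun i => sphereEq (S i) x})
    (hd : Dense {t | (characteristic (circleFamily S) t).Nontrivial}) :
    IsSphereEnvelope (circleFamily S) G where
  smooth := by
    unfold circleFamily
    exact (contDiff_const.add (Real.contDiff_cos.smul contDiff_const)).add
      (Real.contDiff_sin.smul contDiff_const)
  regular t := by
    rw [(hasDerivAt_circleFamily S t).deriv, LinearIndependent.pair_iff]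
    intro u v huv
    have h := Fintype.linearIndependent_iff.mp hS
      ![u, u * Real.cos t - v * Real.sin t, u * Real.sin t + v * Real.cos t] (by
        rw [← huv]
        simp only [Fin.sum_univ_three, Matrix.cons_val, circleFamily]
        module)
    have hsc := Real.sin_sq_add_cos_sq t
    have h0 := h 0
    have h1 := h 1
    have h2 := h 2
    simp at h0 h1 h2
    subst h0
    refine ⟨rfl, ?_⟩
    linear_combination -v * hsc - Real.sin t * h1 + Real.cos t * h2
  circles := hd
  envelope := by
    rw [hG]
    ext x
    simp only [Set.mem_ofPred_eq, Set.mem_iUnion, mem_characteristic_circleFamily]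
    constructor
    · intro h
      obtain ⟨m, t, h⟩ := OnCone.exists_eq_smul_coneRay h
      exact ⟨t, m, h⟩
    · rintro ⟨t, m, h⟩
      rw [h]
      exact onCone_smul_coneRay m t

/-- Removing from s its projection to a leaves a vector orthogonal to a, hence to s, hence to
itself. -/
theorem eq_smul_of_orthogonal {a s : Fin 3 → ℝ} (ha : a ≠ 0)
    (h : ∀ y : Fin 3 → ℝ, y ⬝ᵥ a = 0 → y ⬝ᵥ s = 0) : ∃ m : ℝ, s = m • a := by
  have haa : a ⬝ᵥ a ≠ 0 := by simpa using ha
  refine ⟨(s ⬝ᵥ a) / (a ⬝ᵥ a), ?_⟩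
  set y := s - ((s ⬝ᵥ a) / (a ⬝ᵥ a)) • a with hy
  have h1 : y ⬝ᵥ a = 0 := by
    rw [hy, sub_dotProduct, smul_dotProduct, smul_eq_mul, div_mul_cancel₀ _ haa, sub_self]
  have h2 : y ⬝ᵥ y = 0 := by
    nth_rewrite 2 [hy]
    rw [dotProduct_sub, dotProduct_smul, h y h1, h1]; simp
  exact sub_eq_zero.mp (by simpa using h2)

/-- The reflection of the cone that turns the polarity with respect to the cone into orthogonality. -/
def coneFlip (z : Fin 3 → ℝ) : Fin 3 → ℝ := ![-z 0, z 1, z 2]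

theorem coneFlip_coneFlip (z : Fin 3 → ℝ) : coneFlip (coneFlip z) = z := by
  ext i; fin_cases i <;> simp [coneFlip]

theorem coneFlip_ne_zero {z : Fin 3 → ℝ} (hz : z ≠ 0) : coneFlip z ≠ 0 := by
  intro h
  apply hz
  rw [← coneFlip_coneFlip z, h]
  ext i; fin_cases i <;> simp [coneFlip]

theorem dotProduct_coneFlip (y z : Fin 3 → ℝ) :
    y ⬝ᵥ coneFlip z = y 1 * z 1 + y 2 * z 2 - y 0 * z 0 := by
  simp [coneFlip, dotProduct, Fin.sum_univ_three]; ring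

theorem coneFlip_dotProduct (y z : Fin 3 → ℝ) : coneFlip y ⬝ᵥ z = y ⬝ᵥ coneFlip z := by
  simp [coneFlip, dotProduct, Fin.sum_univ_three]

theorem onCone_iff_dotProduct (z : Fin 3 → ℝ) : OnCone z ↔ z ⬝ᵥ coneFlip z = 0 := by
  rw [dotProduct_coneFlip, OnCone]
  constructor <;> intro h <;> linarith

theorem OnCone.smul {z : Fin 3 → ℝ} (hz : OnCone z) (r : ℝ) : OnCone (r • z) := by
  unfold OnCone at *
  simp only [Pi.smul_apply, smul_eq_mul]
  linear_combination r ^ 2 * hz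

theorem OnCone.coneFlip {z : Fin 3 → ℝ} (hz : OnCone z) : OnCone (coneFlip z) := by
  simpa [OnCone, _root_.coneFlip] using hz

theorem isClosed_onCone : IsClosed {z | OnCone z} :=
  isClosed_eq (by fun_prop) (by fun_prop)

/-! ### The conic as a linear image of the cone -/

/-- A linear map that takes the cone `z₁² + z₂² = z₀²` to the cone of homogeneous coordinates of
the points of the conic. -/
def ConicShape.param : ConicShape → Matrix (Fin 3) (Fin 3) ℝ
  | .ellipse a b _ _ => !![1, 0, 0; 0, a, 0; 0, 0, b]
  | .hyperbola a b _ _ => !![0, 1, 0; a, 0, 0; 0, 0, b]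
  | .parabola p _ => !![1, 1, 0; 1 / (2 * p), -(1 / (2 * p)), 0; 0, 0, 1]

theorem ConicShape.isUnit_det_param (q : ConicShape) : IsUnit q.param.det := by
  rw [isUnit_iff_ne_zero]
  cases q with
  | ellipse a b hb hab =>
    have : 0 < a := hb.trans_le hab
    simp [param, Matrix.det_fin_three, hb.ne', this.ne']
  | hyperbola a b ha hb => simp [param, Matrix.det_fin_three, hb.ne', ha.ne']
  | parabola p hp =>
    simp only [param, Matrix.det_fin_three, Matrix.of_apply, Matrix.cons_val]
    have : (0 : ℝ) < 1 / (2 * p) := by positivity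
    linarith

/-- All three normal forms are congruent to ε diag(-1, 1, 1). For the hyperbola ε = -1, since there
x, not w, plays the role of z₀; the parabola uses 2pwx = z₀² - z₁². -/
theorem ConicShape.exists_matrix_param (q : ConicShape) : ∃ ε : ℝ, ε ≠ 0 ∧ ∀ y z : Fin 3 → ℝ,
    q.param.mulVec y ⬝ᵥ q.matrix.mulVec (q.param.mulVec z) = ε * (y ⬝ᵥ coneFlip z) := by
  simp only [dotProduct_coneFlip]
  cases q with
  | ellipse a b hb hab =>
    have ha : a ≠ 0 := (hb.trans_le hab).ne'
    have hb := hb.ne'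
    refine ⟨1, one_ne_zero, fun y z => ?_⟩
    simp [param, matrix, Matrix.mulVec, dotProduct, Fin.sum_univ_three]
    field_simp
    ring
  | hyperbola a b ha hb =>
    have ha := ha.ne'
    have hb := hb.ne'
    refine ⟨-1, by norm_num, fun y z => ?_⟩
    simp [param, matrix, Matrix.mulVec, dotProduct, Fin.sum_univ_three]
    field_simp
    ring
  | parabola p hp =>
    have hp := hp.ne'
    refine ⟨1, one_ne_zero, fun y z => ?_⟩
    simp [param, matrix, Matrix.mulVec, dotProduct, Fin.sum_univ_three]
    field_simp
    ring

theorem ConicShape.param_mulVec_surjective (q : ConicShape) (v : Fin 3 → ℝ) :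
    ∃ z, v = q.param.mulVec z :=
  ⟨q.param⁻¹.mulVec v, by
    rw [Matrix.mulVec_mulVec, Matrix.mul_nonsing_inv _ q.isUnit_det_param, Matrix.one_mulVec]⟩

theorem ConicShape.param_mulVec_ne_zero (q : ConicShape) {z : Fin 3 → ℝ} (hz : z ≠ 0) :
    q.param.mulVec z ≠ 0 := by
  intro h
  apply hz
  rw [← Matrix.one_mulVec z, ← Matrix.nonsing_inv_mul _ q.isUnit_det_param,
    ← Matrix.mulVec_mulVec, h, Matrix.mulVec_zero]

namespace Conic

variable (c : Conic)

/-- The line coordinates `c.trace n e`, transformed to the cone `z₁² + z₂² = z₀²`. -/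
def coneTrace (n : E3) (e : ℝ) : Fin 3 → ℝ := c.shape.param.transpose.mulVec (c.trace n e)

theorem param_mulVec_dotProduct_trace (y : Fin 3 → ℝ) (n : E3) (e : ℝ) :
    c.shape.param.mulVec y ⬝ᵥ c.trace n e = y ⬝ᵥ c.coneTrace n e := by
  rw [coneTrace, Matrix.mulVec_transpose, dotProduct_comm, Matrix.dotProduct_mulVec,
    dotProduct_comm]

/-- The plane `⟪n, x⟫ = e` contains the polar line of the point `v` of the carrier plane. -/
def ContainsPolar (v : Fin 3 → ℝ) (n : E3) (e : ℝ) : Prop :=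
  ∀ w : Fin 3 → ℝ, w ⬝ᵥ c.shape.matrix.mulVec v = 0 → w ⬝ᵥ c.trace n e = 0

theorem param_mulVec_onConic_iff (z : Fin 3 → ℝ) :
    c.shape.param.mulVec z ⬝ᵥ c.shape.matrix.mulVec (c.shape.param.mulVec z) = 0 ↔ OnCone z := by
  obtain ⟨ε, hε, h⟩ := c.shape.exists_matrix_param
  rw [h, onCone_iff_dotProduct, mul_eq_zero, or_iff_right hε]

theorem containsPolar_param_iff {z : Fin 3 → ℝ} (hz : z ≠ 0) (n : E3) (e : ℝ) :
    c.ContainsPolar (c.shape.param.mulVec z) n e ↔ ∃ m : ℝ, c.coneTrace n e = m • coneFlip z := by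
  obtain ⟨ε, hε, h⟩ := c.shape.exists_matrix_param
  constructor
  · intro hc
    refine eq_smul_of_orthogonal (coneFlip_ne_zero hz) fun y hy => ?_
    rw [← param_mulVec_dotProduct_trace]
    exact hc _ (by rw [h, hy, mul_zero])
  · rintro ⟨m, hm⟩ w hw
    obtain ⟨y, rfl⟩ := c.shape.param_mulVec_surjective w
    rw [h, mul_eq_zero, or_iff_right hε] at hw
    rw [param_mulVec_dotProduct_trace, hm, dotProduct_smul, hw, smul_zero]

theorem onCone_coneTrace_of_containsPolar {v : Fin 3 → ℝ} (hv : v ≠ 0)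
    (hvc : v ⬝ᵥ c.shape.matrix.mulVec v = 0) {n : E3} {e : ℝ} (h : c.ContainsPolar v n e) :
    OnCone (c.coneTrace n e) := by
  obtain ⟨z, rfl⟩ := c.shape.param_mulVec_surjective v
  have hz : z ≠ 0 := by rintro rfl; simp at hv
  rw [param_mulVec_onConic_iff] at hvc
  obtain ⟨m, hm⟩ := (c.containsPolar_param_iff hz n e).mp h
  rw [hm]
  exact hvc.coneFlip.smul m

theorem mem_tangentPlanes_iff (n : E3) (e : ℝ) :
    (n, e) ∈ c.tangentPlanes ↔ n ≠ 0 ∧ OnCone (c.coneTrace n e) := by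
  refine and_congr_right fun _ => ⟨?_, fun h => ?_⟩
  · rintro ⟨v, hv, hvc, h⟩
    exact c.onCone_coneTrace_of_containsPolar hv hvc h
  · suffices ∃ z, z ≠ 0 ∧ OnCone z ∧ ∃ m : ℝ, c.coneTrace n e = m • coneFlip z by
      obtain ⟨z, hz, hzc, hm⟩ := this
      exact ⟨c.shape.param.mulVec z, c.shape.param_mulVec_ne_zero hz,
        (c.param_mulVec_onConic_iff z).mpr hzc, (c.containsPolar_param_iff hz n e).mpr hm⟩
    -- The carrier plane has trace zero and contains every tangent, so any point of the cone serves.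
    -- Otherwise the contact point is the pole of the trace.
    by_cases h0 : c.coneTrace n e = 0
    · exact ⟨![1, 1, 0], by simp, by simp [OnCone], 0, by simp [h0]⟩
    · exact ⟨coneFlip (c.coneTrace n e), coneFlip_ne_zero h0, h.coneFlip, 1, by
        rw [coneFlip_coneFlip, one_smul]⟩

/-- The linear form on the cone whose zeros are the tangents at the points at infinity. -/
def infinityForm : Fin 3 → ℝ := coneFlip (c.shape.param 0)

theorem infinityForm_ne_zero : c.infinityForm ≠ 0 := by
  refine coneFlip_ne_zero fun h => c.shape.isUnit_det_param.ne_zero ?_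
  exact Matrix.det_eq_zero_of_row_eq_zero 0 fun j => congrFun h j

/-- A tangent plane touches the conic at a proper point if its `infinityForm` is not zero. -/
theorem exists_affine_containsPolar {n : E3} {e : ℝ} (h : OnCone (c.coneTrace n e))
    (h0 : c.infinityForm ⬝ᵥ c.coneTrace n e ≠ 0) :
    ∃ v : Fin 3 → ℝ, v 0 = 1 ∧ v ⬝ᵥ c.shape.matrix.mulVec v = 0 ∧ c.ContainsPolar v n e := by
  set r := c.infinityForm ⬝ᵥ c.coneTrace n e with hr
  have hz : r⁻¹ • coneFlip (c.coneTrace n e) ≠ 0 := by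
    refine smul_ne_zero (inv_ne_zero h0) (coneFlip_ne_zero ?_)
    intro h1
    rw [h1, dotProduct_zero] at hr
    exact h0 hr
  -- The contact point has zeroth coordinate r before scaling; division by r makes it affine.
  refine ⟨c.shape.param.mulVec (r⁻¹ • coneFlip (c.coneTrace n e)), ?_,
    (c.param_mulVec_onConic_iff _).mpr (h.coneFlip.smul _),
    (c.containsPolar_param_iff hz n e).mpr ⟨r, ?_⟩⟩
  · rw [Matrix.mulVec_smul, Pi.smul_apply, Matrix.mulVec, ← coneFlip_dotProduct,
      show coneFlip (c.shape.param 0) = c.infinityForm from rfl, ← hr, smul_eq_mul,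
      inv_mul_cancel₀ h0]
  · ext i
    fin_cases i <;> simp [coneFlip] <;> field_simp

/-! ### Coordinates of planes -/

/-- The plane with prescribed `coneTrace` and prescribed third component of the normal vector. -/
def planeOf (s : Fin 3 → ℝ) (g : ℝ) : E3 × ℝ :=
  let t := c.shape.param⁻¹.transpose.mulVec s
  let n := t 1 • c.frame 0 + t 2 • c.frame 1 + g • c.frame 2
  (n, ⟪n, c.origin⟫ - t 0)

theorem inner_frame (i j : Fin 3) : ⟪c.frame i, c.frame j⟫ = if i = j then 1 else 0 :=
  orthonormal_iff_ite.mp c.frame.orthonormal i j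

theorem inner_combo_frame (r : Fin 3 → ℝ) (i : Fin 3) :
    ⟪r 0 • c.frame 0 + r 1 • c.frame 1 + r 2 • c.frame 2, c.frame i⟫ = r i := by
  simp only [inner_add_left, real_inner_smul_left, inner_frame]
  fin_cases i <;> simp

theorem eq_combo_frame (x : E3) :
    x = ⟪x, c.frame 0⟫ • c.frame 0 + ⟪x, c.frame 1⟫ • c.frame 1 + ⟪x, c.frame 2⟫ • c.frame 2 := by
  have := c.frame.sum_repr' x
  simp only [Fin.sum_univ_three] at this
  rw [real_inner_comm x, real_inner_comm x, real_inner_comm x] at this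
  exact this.symm

theorem inner_eq_frame (x y : E3) : ⟪x, y⟫ = ⟪x, c.frame 0⟫ * ⟪y, c.frame 0⟫ +
    ⟪x, c.frame 1⟫ * ⟪y, c.frame 1⟫ + ⟪x, c.frame 2⟫ * ⟪y, c.frame 2⟫ := by
  conv_lhs => rw [c.eq_combo_frame y]
  simp only [inner_add_right, real_inner_smul_right]
  ring

theorem coneTrace_planeOf (s : Fin 3 → ℝ) (g : ℝ) :
    c.coneTrace (c.planeOf s g).1 (c.planeOf s g).2 = s := by
  set t := c.shape.param⁻¹.transpose.mulVec s with ht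
  have h : c.trace (c.planeOf s g).1 (c.planeOf s g).2 = t := by
    have h0 := c.inner_combo_frame ![t 1, t 2, g] 0
    have h1 := c.inner_combo_frame ![t 1, t 2, g] 1
    simp only [Matrix.cons_val] at h0 h1
    ext i
    fin_cases i
    · simp [trace, planeOf, ← ht]
    · simpa [trace, planeOf, ← ht] using h0
    · simpa [trace, planeOf, ← ht] using h1
  rw [coneTrace, h, ht, Matrix.mulVec_mulVec, ← Matrix.transpose_mul,
    Matrix.nonsing_inv_mul _ c.shape.isUnit_det_param, Matrix.transpose_one, Matrix.one_mulVec]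

theorem planeOf_coneTrace (n : E3) (e : ℝ) :
    c.planeOf (c.coneTrace n e) ⟪n, c.frame 2⟫ = (n, e) := by
  have h : c.shape.param⁻¹.transpose.mulVec (c.coneTrace n e) = c.trace n e := by
    rw [coneTrace, Matrix.mulVec_mulVec, ← Matrix.transpose_mul,
      Matrix.mul_nonsing_inv _ c.shape.isUnit_det_param, Matrix.transpose_one, Matrix.one_mulVec]
  have h1 : (c.planeOf (c.coneTrace n e) ⟪n, c.frame 2⟫).1 = n := by
    simp only [planeOf, h]
    exact (c.eq_combo_frame n).symm
  refine Prod.ext h1 ?_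
  change ⟪(c.planeOf (c.coneTrace n e) ⟪n, c.frame 2⟫).1, c.origin⟫ - _ = e
  rw [h1, h]
  simp [trace]

theorem inner_planeOf_frame_two (s : Fin 3 → ℝ) (g : ℝ) :
    ⟪(c.planeOf s g).1, c.frame 2⟫ = g :=
  c.inner_combo_frame ![_, _, g] 2

/-- The linear form on the cone whose zeros are the tangents through the projection of `O`. -/
def centerForm : Fin 3 → ℝ :=
  c.shape.param⁻¹.mulVec ![-1, ⟪c.origin, c.frame 0⟫, ⟪c.origin, c.frame 1⟫]

theorem centerForm_ne_zero : c.centerForm ≠ 0 := by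
  intro h
  have h1 : c.shape.param.mulVec c.centerForm =
      ![-1, ⟪c.origin, c.frame 0⟫, ⟪c.origin, c.frame 1⟫] := by
    rw [centerForm, Matrix.mulVec_mulVec, Matrix.mul_nonsing_inv _ c.shape.isUnit_det_param,
      Matrix.one_mulVec]
  rw [h, Matrix.mulVec_zero] at h1
  simpa using congrFun h1 0

/-- This is the source of the later case distinctions: e can be controlled through g when O is off
the carrier plane, and only through s when O lies in it. -/
theorem planeOf_snd (s : Fin 3 → ℝ) (g : ℝ) :
    (c.planeOf s g).2 = c.centerForm ⬝ᵥ s + g * ⟪c.origin, c.frame 2⟫ := by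
  have h : c.centerForm ⬝ᵥ s = ![-1, ⟪c.origin, c.frame 0⟫, ⟪c.origin, c.frame 1⟫] ⬝ᵥ
      c.shape.param⁻¹.transpose.mulVec s := by
    rw [centerForm, Matrix.mulVec_transpose, dotProduct_comm, Matrix.dotProduct_mulVec,
      dotProduct_comm]
  rw [h]
  simp only [planeOf, inner_add_right, real_inner_smul_right, dotProduct, Fin.sum_univ_three,
    Matrix.cons_val, real_inner_comm c.origin]
  ring

theorem continuous_planeOf_left (g : ℝ) : Continuous fun s => c.planeOf s g := by
  have h : Continuous fun s : Fin 3 → ℝ => c.shape.param⁻¹.transpose.mulVec s :=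
    Continuous.matrix_mulVec continuous_const continuous_id
  unfold planeOf
  fun_prop

theorem continuous_planeOf_right (s : Fin 3 → ℝ) : Continuous fun g => c.planeOf s g := by
  unfold planeOf
  fun_prop

theorem continuous_coneTrace : Continuous fun E : E3 × ℝ => c.coneTrace E.1 E.2 := by
  refine Continuous.matrix_mulVec continuous_const (continuous_pi fun i => ?_)
  fin_cases i <;> simp [trace] <;> fun_prop

theorem coneTrace_smul (r : ℝ) (n : E3) (e : ℝ) :
    c.coneTrace (r • n) (r * e) = r • c.coneTrace n e := by
  rw [coneTrace, coneTrace, ← Matrix.mulVec_smul]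
  congr 1
  ext i
  fin_cases i <;> simp [trace, real_inner_smul_left]
  ring

/-! ### The pedal surface -/

/-- The pair consisting of the foot and its squared norm is (n, e) scaled by e / ‖n‖². -/
theorem coneTrace_footPoint {n : E3} (hn : n ≠ 0) (e : ℝ) :
    c.coneTrace (footPoint (n, e)) (‖footPoint (n, e)‖ ^ 2) =
      (e / ‖n‖ ^ 2) • c.coneTrace n e := by
  have hn' : ‖n‖ ≠ 0 := norm_ne_zero_iff.mpr hn
  rw [← coneTrace_smul]
  congr 1
  rw [footPoint, norm_smul, mul_pow, Real.norm_eq_abs, sq_abs]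
  field_simp

theorem footPoint_self (x : E3) : footPoint (x, ‖x‖ ^ 2) = x := by
  by_cases hx : x = 0
  · simp [footPoint, hx]
  · have : ‖x‖ ^ 2 ≠ 0 := pow_ne_zero _ (norm_ne_zero_iff.mpr hx)
    rw [footPoint, div_self this, one_smul]

theorem coneTrace_zero : c.coneTrace 0 0 = 0 := by
  simpa using c.coneTrace_smul 0 0 0

theorem planeOf_fst_ne_zero_of_right {g : ℝ} (hg : g ≠ 0) (s : Fin 3 → ℝ) :
    (c.planeOf s g).1 ≠ 0 := by
  intro h
  have := c.inner_planeOf_frame_two s g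
  rw [h, inner_zero_left] at this
  exact hg this.symm

theorem coneRay_ne_zero (t : ℝ) : coneRay t ≠ 0 := by
  intro h
  simpa [coneRay] using congrFun h 0

/-- Needed for the point O of the pedal surface: (0, 0) satisfies the cone equation but is not a
plane. If O lies in the carrier plane, that plane serves; otherwise a tangent line is joined with O.
-/
theorem exists_tangentPlane_through_zero : ∃ n : E3, (n, (0 : ℝ)) ∈ c.tangentPlanes := by
  suffices ∃ s g, OnCone s ∧ (c.planeOf s g).1 ≠ 0 ∧ (c.planeOf s g).2 = 0 by
    obtain ⟨s, g, hs, h1, h2⟩ := this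
    refine ⟨(c.planeOf s g).1, (c.mem_tangentPlanes_iff _ _).mpr ⟨h1, ?_⟩⟩
    rw [← h2, coneTrace_planeOf]
    exact hs
  by_cases ho : ⟪c.origin, c.frame 2⟫ = 0
  · refine ⟨0, 1, by simp [OnCone], c.planeOf_fst_ne_zero_of_right one_ne_zero 0, ?_⟩
    rw [planeOf_snd, ho]; simp
  · have h2 : (c.planeOf (coneRay 0)
        (-(c.centerForm ⬝ᵥ coneRay 0) / ⟪c.origin, c.frame 2⟫)).2 = 0 := by
      rw [planeOf_snd]; field_simp; ring
    refine ⟨_, _, by simpa using onCone_smul_coneRay 1 0, fun h1 => coneRay_ne_zero 0 ?_, h2⟩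
    rw [← c.coneTrace_planeOf (coneRay 0) (-(c.centerForm ⬝ᵥ coneRay 0) / ⟪c.origin, c.frame 2⟫),
      h1, h2, coneTrace_zero]

theorem mem_pedal_tangentPlanes_iff (x : E3) :
    x ∈ pedal c.tangentPlanes ↔ OnCone (c.coneTrace x (‖x‖ ^ 2)) := by
  constructor
  · rintro ⟨⟨n, e⟩, ⟨hE, hn⟩, rfl⟩
    rw [c.coneTrace_footPoint hn]
    exact ((c.mem_tangentPlanes_iff n e).mp hE).2.smul _
  · intro h
    by_cases hx : x = 0
    · obtain ⟨n, hn⟩ := c.exists_tangentPlane_through_zero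
      exact ⟨(n, 0), ⟨hn, hn.1⟩, by simp [footPoint, hx]⟩
    · exact ⟨(x, ‖x‖ ^ 2), ⟨(c.mem_tangentPlanes_iff _ _).mpr ⟨hx, h⟩, hx⟩, footPoint_self x⟩

/-! ### The dual quadric -/

/-- The matrix of the linear map that takes plane coordinates to the `coneTrace`. -/
def planeMatrix : Matrix (Fin 3) (Fin 4) ℝ :=
  c.shape.param.transpose * Matrix.of ![![1, c.origin 0, c.origin 1, c.origin 2],
    ![0, c.frame 0 0, c.frame 0 1, c.frame 0 2], ![0, c.frame 1 0, c.frame 1 1, c.frame 1 2]]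

/-- The matrix of the quadratic form `z₁² + z₂² - z₀²`. -/
def coneMatrix : Matrix (Fin 3) (Fin 3) ℝ := Matrix.diagonal ![-1, 1, 1]

/-- The symmetric matrix of the conic as a dual quadric. -/
def dualMatrix : Matrix (Fin 4) (Fin 4) ℝ := c.planeMatrix.transpose * coneMatrix * c.planeMatrix

theorem planeMatrix_mulVec (n : E3) (e : ℝ) :
    c.planeMatrix.mulVec ![-e, n 0, n 1, n 2] = c.coneTrace n e := by
  rw [planeMatrix, ← Matrix.mulVec_mulVec, coneTrace]
  congr 1
  ext i
  fin_cases i <;>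
    simp [trace, Matrix.mulVec, dotProduct, Fin.sum_univ_succ, PiLp.inner_apply]
  ring

theorem dualMatrix_isSymm : c.dualMatrix.IsSymm := by
  rw [Matrix.IsSymm, dualMatrix, Matrix.transpose_mul, Matrix.transpose_mul,
    Matrix.transpose_transpose, coneMatrix, Matrix.diagonal_transpose, Matrix.mul_assoc]

theorem dotProduct_dualMatrix (U : Fin 4 → ℝ) : U ⬝ᵥ c.dualMatrix.mulVec U =
    c.planeMatrix.mulVec U ⬝ᵥ coneFlip (c.planeMatrix.mulVec U) := by
  have h : ∀ z, coneMatrix.mulVec z = coneFlip z := by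
    intro z
    ext i
    fin_cases i <;> simp [coneMatrix, Matrix.mulVec_diagonal, coneFlip]
  rw [dualMatrix, ← Matrix.mulVec_mulVec, ← Matrix.mulVec_mulVec, h, Matrix.mulVec_transpose,
    dotProduct_comm U, ← Matrix.dotProduct_mulVec, dotProduct_comm]

/-- A right inverse S of `planeMatrix`, built from `planeOf`, compresses the dual quadric to the
invertible `coneMatrix`, which bounds the rank from below. -/
theorem dualMatrix_rank : c.dualMatrix.rank = 3 := by
  let S : Matrix (Fin 4) (Fin 3) ℝ := Matrix.of fun i j =>
    ![-(c.planeOf (Pi.single j 1) 0).2, (c.planeOf (Pi.single j 1) 0).1 0,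
      (c.planeOf (Pi.single j 1) 0).1 1, (c.planeOf (Pi.single j 1) 0).1 2] i
  have hS : c.planeMatrix * S = 1 := by
    ext i j
    have h := congrFun (c.planeMatrix_mulVec (c.planeOf (Pi.single j 1) 0).1
      (c.planeOf (Pi.single j 1) 0).2) i
    rw [coneTrace_planeOf] at h
    rw [Matrix.one_apply, ← Pi.single_apply j (1 : ℝ) i, ← h]
    rfl
  have hD : S.transpose * c.dualMatrix * S = coneMatrix := by
    rw [dualMatrix]
    calc _ = (c.planeMatrix * S).transpose * coneMatrix * (c.planeMatrix * S) := by
          simp only [Matrix.transpose_mul, Matrix.mul_assoc]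
      _ = _ := by rw [hS]; simp
  have hr : coneMatrix.rank = 3 := by
    have : IsUnit coneMatrix := by
      rw [Matrix.isUnit_iff_isUnit_det, coneMatrix, Matrix.det_diagonal]
      simp [Fin.prod_univ_three]
    rw [Matrix.rank_of_isUnit _ this]; simp
  apply le_antisymm
  · calc c.dualMatrix.rank ≤ c.planeMatrix.rank := Matrix.rank_mul_le_right _ _
      _ ≤ 3 := by simpa using c.planeMatrix.rank_le_height
  · rw [← hr, ← hD]
    exact (Matrix.rank_mul_le_left _ _).trans (Matrix.rank_mul_le_right _ _)

theorem mem_tangentPlanes_iff_dualMatrix {n : E3} (hn : n ≠ 0) (e : ℝ) :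
    (n, e) ∈ c.tangentPlanes ↔
      ![-e, n 0, n 1, n 2] ⬝ᵥ c.dualMatrix.mulVec ![-e, n 0, n 1, n 2] = 0 := by
  rw [mem_tangentPlanes_iff, dotProduct_dualMatrix, planeMatrix_mulVec, ← onCone_iff_dotProduct]
  simp [hn]

/-! ### The pedal surface as a Darboux cyclide -/

/-- The matrix that takes pentaspherical coordinates of `x` to the plane with foot point `x`. -/
def footMatrix : Matrix (Fin 4) (Fin 5) ℝ :=
  !![-1, 0, 0, 0, -1; 0, 1, 0, 0, 0; 0, 0, 1, 0, 0; 0, 0, 0, 1, 0]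

theorem footMatrix_mulVec (x : E3) :
    footMatrix.mulVec (pentaspherical x) = ![-‖x‖ ^ 2, x 0, x 1, x 2] := by
  ext i
  fin_cases i <;> simp [footMatrix, pentaspherical, Matrix.mulVec, dotProduct, Fin.sum_univ_succ]
  ring

theorem pentaspherical_dualMatrix (x : E3) :
    pentaspherical x ⬝ᵥ (footMatrix.transpose * c.dualMatrix * footMatrix).mulVec
      (pentaspherical x) = c.coneTrace x (‖x‖ ^ 2) ⬝ᵥ coneFlip (c.coneTrace x (‖x‖ ^ 2)) := by
  rw [← Matrix.mulVec_mulVec, ← Matrix.mulVec_mulVec, footMatrix_mulVec, Matrix.mulVec_transpose,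
    dotProduct_comm, ← Matrix.dotProduct_mulVec, footMatrix_mulVec, dotProduct_comm,
    dotProduct_dualMatrix, planeMatrix_mulVec]

/-- The spheres through `O` whose equations are the components of `coneTrace x ‖x‖²`. -/
def baseSphere (j : Fin 3) : ℝ × E3 × ℝ :=
  (-c.shape.param 0 j, c.shape.param 0 j • c.origin + c.shape.param 1 j • c.frame 0 +
    c.shape.param 2 j • c.frame 1, 0)

theorem sphereEq_baseSphere (j : Fin 3) (x : E3) :
    sphereEq (c.baseSphere j) x = c.coneTrace x (‖x‖ ^ 2) j := by
  simp only [sphereEq, baseSphere, coneTrace, trace, Matrix.mulVec, dotProduct, Fin.sum_univ_three,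
    Matrix.cons_val, Matrix.transpose_apply, inner_add_left, real_inner_smul_left,
    real_inner_comm _ x]
  ring

theorem _root_.hasFDerivAt_sphereEq (s : ℝ × E3 × ℝ) (x : E3) :
    HasFDerivAt (sphereEq s) (s.1 • (2 • innerSL ℝ x) + innerSL ℝ s.2.1) x := by
  have h1 := ((hasFDerivAt_id (𝕜 := ℝ) x).norm_sq).const_smul s.1
  have h2 := ((innerSL ℝ s.2.1).hasFDerivAt (x := x))
  exact (h1.add h2).add_const s.2.2

/-- Orthogonally to the carrier plane the three derivatives share a factor and are otherwise row 0
of `param`. The derivative of the cone equation thus becomes a multiple of `infinityForm`. -/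
theorem baseSphere_deriv_frame_two (j : Fin 3) (x : E3) :
    ((c.baseSphere j).1 • (2 • innerSL ℝ x) + innerSL ℝ (c.baseSphere j).2.1) (c.frame 2) =
      (⟪c.origin, c.frame 2⟫ - 2 * ⟪x, c.frame 2⟫) * c.shape.param 0 j := by
  simp [baseSphere]
  ring

theorem fderiv_cone_ne_zero {x : E3} (h1 : ⟪c.origin, c.frame 2⟫ ≠ 2 * ⟪x, c.frame 2⟫)
    (h2 : c.infinityForm ⬝ᵥ c.coneTrace x (‖x‖ ^ 2) ≠ 0) :
    fderiv ℝ (fun z : E3 =>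
      c.coneTrace z (‖z‖ ^ 2) ⬝ᵥ coneFlip (c.coneTrace z (‖z‖ ^ 2))) x ≠ 0 := by
  have hf : (fun z : E3 => c.coneTrace z (‖z‖ ^ 2) ⬝ᵥ coneFlip (c.coneTrace z (‖z‖ ^ 2))) =
      fun z => sphereEq (c.baseSphere 1) z * sphereEq (c.baseSphere 1) z +
        sphereEq (c.baseSphere 2) z * sphereEq (c.baseSphere 2) z -
        sphereEq (c.baseSphere 0) z * sphereEq (c.baseSphere 0) z := by
    ext z
    simp only [dotProduct_coneFlip, sphereEq_baseSphere]
  obtain ⟨l, hd, hl⟩ : ∃ l : Fin 3 → E3 →L[ℝ] ℝ,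
      (∀ j, HasFDerivAt (sphereEq (c.baseSphere j)) (l j) x) ∧ ∀ j, l j (c.frame 2) =
        (⟪c.origin, c.frame 2⟫ - 2 * ⟪x, c.frame 2⟫) * c.shape.param 0 j :=
    ⟨_, fun j => hasFDerivAt_sphereEq _ x, fun j => c.baseSphere_deriv_frame_two j x⟩
  have hd' := (((hd 1).mul (hd 1)).add ((hd 2).mul (hd 2))).sub ((hd 0).mul (hd 0))
  rw [hf]
  intro h0
  have h := congrArg (fun l : E3 →L[ℝ] ℝ => l (c.frame 2)) (hd'.fderiv.symm.trans h0)
  simp [hl, sphereEq_baseSphere] at h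
  refine mul_ne_zero (sub_ne_zero.mpr h1) h2 ?_
  rw [infinityForm, coneFlip_dotProduct, dotProduct_coneFlip]
  linear_combination h / 2

/-- For n = 0 the `coneTrace` is a multiple of row 0 of `param`, and `infinityForm` is the polar
form of that row. Hence, for a trace on the cone, a nonzero value of the form forces n ≠ 0. -/
theorem infinityForm_dotProduct_coneTrace_zero_left {e : ℝ} (h : OnCone (c.coneTrace 0 e)) :
    c.infinityForm ⬝ᵥ c.coneTrace 0 e = 0 := by
  have h0 : c.coneTrace 0 e = (-e) • c.shape.param 0 := by
    ext j
    simp [coneTrace, trace, Matrix.mulVec, dotProduct, Fin.sum_univ_three]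
    ring
  rw [onCone_iff_dotProduct, h0] at h
  rw [h0, infinityForm, coneFlip_dotProduct]
  by_cases he : e = 0
  · subst he; simp [dotProduct_coneFlip]
  · simp only [dotProduct_coneFlip, Pi.smul_apply, smul_eq_mul] at h ⊢
    have : (-e) ≠ 0 := neg_ne_zero.mpr he
    apply mul_left_cancel₀ this
    linear_combination h

theorem isDarbouxCyclide_pedal : IsDarbouxCyclide (pedal c.tangentPlanes) := by
  refine ⟨footMatrix.transpose * c.dualMatrix * footMatrix, ?_, ?_, ?_⟩
  · rw [Matrix.IsSymm, Matrix.transpose_mul, Matrix.transpose_mul, Matrix.transpose_transpose,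
      c.dualMatrix_isSymm.eq, Matrix.mul_assoc]
  · ext x
    rw [mem_pedal_tangentPlanes_iff, onCone_iff_dotProduct, ← pentaspherical_dualMatrix]
    rfl
  · simp only [pentaspherical_dualMatrix]
    have hd := (dense_dotProduct_coneRay_ne_zero c.infinityForm_ne_zero).inter_of_isOpen_right
      (dense_dotProduct_coneRay_ne_zero c.centerForm_ne_zero)
      (isOpen_ne_fun (Continuous.dotProduct continuous_const continuous_coneRay) continuous_const)
    obtain ⟨t, ht1, ht2⟩ := hd.nonempty
    have hray : OnCone (coneRay t) := by simpa using onCone_smul_coneRay 1 t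
    -- The product being zero keeps e independent of g, while either choice of g makes the first
    -- factor of the normal derivative nonzero.
    obtain ⟨g, hg, hgo⟩ : ∃ g : ℝ, g * ⟪c.origin, c.frame 2⟫ = 0 ∧
        (⟪c.origin, c.frame 2⟫ = 0 ∧ g = 1 ∨ ⟪c.origin, c.frame 2⟫ ≠ 0 ∧ g = 0) := by
      by_cases ho : ⟪c.origin, c.frame 2⟫ = 0
      · exact ⟨1, by simp [ho], Or.inl ⟨ho, rfl⟩⟩
      · exact ⟨0, by simp, Or.inr ⟨ho, rfl⟩⟩
    have hσ := c.coneTrace_planeOf (coneRay t) g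
    have he := c.planeOf_snd (coneRay t) g
    have hγ := c.inner_planeOf_frame_two (coneRay t) g
    rw [hg, add_zero] at he
    set n := (c.planeOf (coneRay t) g).1
    set e := (c.planeOf (coneRay t) g).2
    have he0 : e ≠ 0 := by rw [he]; exact ht2
    have hn : n ≠ 0 := by
      intro hn
      rw [hn] at hσ
      apply ht1
      rw [← hσ]
      exact c.infinityForm_dotProduct_coneTrace_zero_left (hσ ▸ hray)
    have hn' : ‖n‖ ^ 2 ≠ 0 := pow_ne_zero _ (norm_ne_zero_iff.mpr hn)
    refine ⟨footPoint (n, e), ⟨(n, e), ⟨?_, hn⟩, rfl⟩, c.fderiv_cone_ne_zero ?_ ?_⟩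
    · rw [mem_tangentPlanes_iff, hσ]; exact ⟨hn, hray⟩
    · rw [footPoint, real_inner_smul_left, hγ]
      rcases hgo with ⟨ho, rfl⟩ | ⟨ho, rfl⟩
      · rw [ho]
        exact (mul_ne_zero two_ne_zero (mul_ne_zero (div_ne_zero he0 hn') one_ne_zero)).symm
      · simpa using ho
    · rw [c.coneTrace_footPoint hn, hσ, dotProduct_smul]
      exact mul_ne_zero (div_ne_zero he0 hn') ht1

/-! ### The pedal surface as a canal surface -/

theorem linearIndependent_baseSphere : LinearIndependent ℝ c.baseSphere := by
  rw [Fintype.linearIndependent_iff]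
  intro g hg
  have h1 := congrArg Prod.fst hg
  have h2 := congrArg (fun s : ℝ × E3 × ℝ => ⟪s.2.1, c.frame 0⟫) hg
  have h3 := congrArg (fun s : ℝ × E3 × ℝ => ⟪s.2.1, c.frame 1⟫) hg
  simp [Fin.sum_univ_three, baseSphere, inner_add_left, real_inner_smul_left]
    at h1 h2 h3
  by_contra hne
  refine c.shape.param_mulVec_ne_zero (z := g) (fun h => hne fun i => congrFun h i) ?_
  ext i
  fin_cases i <;> simp [Matrix.mulVec, dotProduct, Fin.sum_univ_three]
  · linear_combination -h1
  · linear_combination h2 + ⟪c.origin, c.frame 0⟫ * h1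
  · linear_combination h3 + ⟪c.origin, c.frame 1⟫ * h1

/-- O lies on every characteristic. A second point is the foot of a suitable tangent plane not
through O: the carrier plane if it misses O, otherwise another plane through the tangent line
belonging to t. -/
theorem dense_nontrivial_characteristic_baseSphere :
    Dense {t | (characteristic (circleFamily c.baseSphere) t).Nontrivial} := by
  refine (dense_dotProduct_coneRay_ne_zero c.centerForm_ne_zero).mono fun t ht => ?_
  simp only [Set.mem_ofPred_eq] at ht ⊢
  have key : ∀ s g, (∃ m : ℝ, s = m • coneRay t) → g ≠ 0 → (c.planeOf s g).2 ≠ 0 →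
      (characteristic (circleFamily c.baseSphere) t).Nontrivial := by
    rintro s g ⟨m, hm⟩ hg he
    have hn := c.planeOf_fst_ne_zero_of_right hg s
    have hn' : ‖(c.planeOf s g).1‖ ^ 2 ≠ 0 := pow_ne_zero _ (norm_ne_zero_iff.mpr hn)
    have hσ := c.coneTrace_footPoint hn (c.planeOf s g).2
    refine ⟨0, ?_, footPoint (c.planeOf s g), ?_, ?_⟩
    · rw [mem_characteristic_circleFamily]
      exact ⟨0, by simp only [sphereEq_baseSphere]; simp [coneTrace_zero]; rfl⟩
    · rw [mem_characteristic_circleFamily]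
      simp only [sphereEq_baseSphere]
      refine ⟨(c.planeOf s g).2 / ‖(c.planeOf s g).1‖ ^ 2 * m, hσ.trans ?_⟩
      rw [coneTrace_planeOf, hm, mul_smul]
    · exact (smul_ne_zero (div_ne_zero he hn') hn).symm
  by_cases ho : ⟪c.origin, c.frame 2⟫ = 0
  · exact key (coneRay t) 1 ⟨1, by simp⟩ one_ne_zero (by rw [planeOf_snd, ho]; simpa using ht)
  · exact key 0 1 ⟨0, by simp⟩ one_ne_zero (by rw [planeOf_snd]; simpa using ho)

theorem isSphereEnvelope_pedal :
    IsSphereEnvelope (circleFamily c.baseSphere) (pedal c.tangentPlanes) := by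
  refine isSphereEnvelope_circleFamily c.linearIndependent_baseSphere ?_
    c.dense_nontrivial_characteristic_baseSphere
  ext x
  rw [mem_pedal_tangentPlanes_iff]
  simp only [sphereEq_baseSphere]
  rfl

/-! ### Dense sets of tangent planes -/

theorem mem_closure_infinityForm_ne_zero {E : E3 × ℝ} (hE : OnCone (c.coneTrace E.1 E.2)) :
    E ∈ closure {E : E3 × ℝ | OnCone (c.coneTrace E.1 E.2) ∧
      c.infinityForm ⬝ᵥ c.coneTrace E.1 E.2 ≠ 0} := by
  have hc := c.continuous_planeOf_left ⟪E.1, c.frame 2⟫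
  have h := map_mem_closure (t := {E : E3 × ℝ | OnCone (c.coneTrace E.1 E.2) ∧
      c.infinityForm ⬝ᵥ c.coneTrace E.1 E.2 ≠ 0}) hc (hE.mem_closure c.infinityForm_ne_zero) (by
    rintro s ⟨h1, h2⟩
    rw [Set.mem_ofPred_eq, coneTrace_planeOf]
    exact ⟨h1, h2⟩)
  rwa [planeOf_coneTrace] at h

/-- If O lies in the carrier plane, e depends on the trace alone and the trace is varied on the
cone; otherwise the plane is turned about its trace. -/
theorem mem_closure_snd_ne_zero {E : E3 × ℝ} (hE : OnCone (c.coneTrace E.1 E.2)) :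
    E ∈ closure {E : E3 × ℝ | OnCone (c.coneTrace E.1 E.2) ∧ E.2 ≠ 0} := by
  by_cases ho : ⟪c.origin, c.frame 2⟫ = 0
  · have hc := c.continuous_planeOf_left ⟪E.1, c.frame 2⟫
    have h := map_mem_closure (t := {E : E3 × ℝ | OnCone (c.coneTrace E.1 E.2) ∧ E.2 ≠ 0}) hc
      (hE.mem_closure c.centerForm_ne_zero) (by
        rintro s ⟨h1, h2⟩
        rw [Set.mem_ofPred_eq, coneTrace_planeOf, planeOf_snd, ho, mul_zero, add_zero]
        exact ⟨h1, h2⟩)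
    rwa [planeOf_coneTrace] at h
  · by_cases he : E.2 = 0
    · have hc := c.continuous_planeOf_right (c.coneTrace E.1 E.2)
      have h := map_mem_closure (t := {E : E3 × ℝ | OnCone (c.coneTrace E.1 E.2) ∧ E.2 ≠ 0}) hc
        (dense_compl_singleton ⟪E.1, c.frame 2⟫ ⟪E.1, c.frame 2⟫) (by
          intro g hg
          rw [Set.mem_ofPred_eq, coneTrace_planeOf]
          refine ⟨hE, fun h0 => hg ?_⟩
          have h1 := congrArg Prod.snd (c.planeOf_coneTrace E.1 E.2)
          rw [planeOf_snd] at h0 h1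
          exact mul_right_cancel₀ ho (by simp only at h1; linarith))
      rwa [planeOf_coneTrace] at h
    · exact subset_closure ⟨hE, he⟩

/-- Planes near a plane with unit normal vector may be normalized. -/
theorem mem_closure_unit {q : Set (E3 × ℝ)} (hq : ∀ (r : ℝ) (E : E3 × ℝ), r ≠ 0 → E ∈ q → r • E ∈ q)
    {E : E3 × ℝ} (hE : ‖E.1‖ = 1)
    (h : E ∈ closure {E : E3 × ℝ | OnCone (c.coneTrace E.1 E.2) ∧ E ∈ q}) :
    E ∈ closure {E : E3 × ℝ | ‖E.1‖ = 1 ∧ OnCone (c.coneTrace E.1 E.2) ∧ E ∈ q} := by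
  have hcont : ContinuousAt (fun E : E3 × ℝ => ‖E.1‖⁻¹ • E) E :=
    (ContinuousAt.inv₀ (f := fun E : E3 × ℝ => ‖E.1‖) (by fun_prop)
      (by rw [hE]; exact one_ne_zero)).smul continuousAt_id
  have hE' : ‖E.1‖⁻¹ • E = E := by rw [hE, inv_one, one_smul]
  rw [ContinuousAt, hE'] at hcont
  have := mem_closure_iff_nhdsWithin_neBot.mp h
  refine mem_closure_of_tendsto (b := nhdsWithin E
    {E : E3 × ℝ | OnCone (c.coneTrace E.1 E.2) ∧ E ∈ q})
    (hcont.mono_left nhdsWithin_le_nhds) ?_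
  have hne : ∀ᶠ E' : E3 × ℝ in nhds E, E'.1 ≠ 0 :=
    continuousAt_fst.eventually_ne (by rw [← norm_ne_zero_iff, hE]; exact one_ne_zero)
  filter_upwards [self_mem_nhdsWithin, nhdsWithin_le_nhds hne] with E' hE1 hE2
  have hn : ‖E'.1‖ ≠ 0 := norm_ne_zero_iff.mpr hE2
  refine ⟨?_, ?_, hq _ _ (inv_ne_zero hn) hE1.2⟩
  · rw [Prod.smul_fst, norm_smul, norm_inv, norm_norm, inv_mul_cancel₀ hn]
  · rw [Prod.smul_fst, Prod.smul_snd, smul_eq_mul, coneTrace_smul]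
    exact hE1.1.smul _

/-! ### The pipe surface -/

theorem mem_offsetPlanes_iff (d : ℝ) (F : Set (E3 × ℝ)) (n : E3) (e : ℝ) :
    (n, e) ∈ offsetPlanes d F ↔ ‖n‖ = 1 ∧ ∃ k, |k| = |d| ∧ (n, e - k) ∈ F := by
  refine and_congr_right fun _ => ⟨?_, ?_⟩
  · rintro (h | h)
    · exact ⟨d, rfl, h⟩
    · exact ⟨-d, abs_neg d, by rwa [sub_neg_eq_add]⟩
  · rintro ⟨k, hk, h⟩
    rcases abs_eq_abs.mp hk with rfl | rfl
    · exact Or.inl h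
    · exact Or.inr (by rwa [sub_neg_eq_add] at h)

theorem hom_dotProduct_trace {X : E3} (hX : c.coord X 2 = 0) (n : E3) (e : ℝ) :
    c.hom X ⬝ᵥ c.trace n e = ⟪n, X⟫ - e := by
  have h := c.inner_eq_frame n (X - c.origin)
  unfold coord at hX
  rw [inner_sub_right, real_inner_comm (c.frame 2) (X - c.origin), hX] at h
  simp only [hom, trace, coord, dotProduct, Fin.sum_univ_three, Matrix.cons_val]
  rw [real_inner_comm (X - c.origin), real_inner_comm (X - c.origin)]
  linarith

theorem dotProduct_trace_of_tangentVector (r s : ℝ) (n : E3) (e : ℝ) :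
    ![0, r, s] ⬝ᵥ c.trace n e = ⟪r • c.frame 0 + s • c.frame 1, n⟫ := by
  simp only [trace, dotProduct, Fin.sum_univ_three, Matrix.cons_val, inner_add_right,
    real_inner_smul_right, real_inner_comm n]
  ring

/-- The plane touches the sphere at Y = X + k n with |k| = |d|; moved back by k it passes through X.
As k ≠ 0, orthogonality of Y - X to the conic says that n is orthogonal to the tangent at X. -/
theorem mem_pipeTangentPlanes_iff {d : ℝ} (hd : d ≠ 0) (n : E3) (e : ℝ) :
    (n, e) ∈ c.pipeTangentPlanes d ↔ ‖n‖ = 1 ∧ ∃ k, |k| = |d| ∧ ∃ v : Fin 3 → ℝ, v 0 = 1 ∧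
      v ⬝ᵥ c.shape.matrix.mulVec v = 0 ∧ c.ContainsPolar v n (e - k) := by
  refine and_congr_right fun hn => ⟨?_, ?_⟩
  · simp only at hn
    rintro ⟨X, hX, Y, hY, ⟨k, hk⟩, he⟩
    simp only at hk he
    have hkd : |k| = |d| := by
      rw [← hY.1, dist_eq_norm, hk, norm_smul, hn, mul_one, Real.norm_eq_abs]
    have hk0 : k ≠ 0 := by rwa [← abs_pos, hkd, abs_pos]
    refine ⟨k, hkd, c.hom X, rfl, hX.2, fun w hw => ?_⟩
    -- A point of the tangent line splits into a multiple of the contact point and a tangent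
    -- direction.
    have h1 : w = w 0 • c.hom X + ![0, w 1 - w 0 * c.coord X 0, w 2 - w 0 * c.coord X 1] := by
      ext i; fin_cases i <;> simp [hom]
    have hnX : ⟪n, X⟫ = e - k := by
      rw [← he, eq_sub_iff_add_eq, ← sub_add_cancel Y X, hk, inner_add_right,
        real_inner_smul_right, real_inner_self_eq_norm_sq, hn]
      ring
    rw [h1, add_dotProduct, smul_dotProduct, hX.2, smul_zero, zero_add] at hw
    rw [h1, add_dotProduct, smul_dotProduct, c.hom_dotProduct_trace hX.1, hnX, sub_self, smul_zero,
      zero_add, dotProduct_trace_of_tangentVector]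
    have h2 := hY.2 _ ⟨_, _, rfl, hw⟩
    rw [hk, real_inner_smul_right] at h2
    exact (mul_eq_zero.mp h2).resolve_left hk0
  · simp only at hn
    rintro ⟨k, hk, v, hv0, hvc, hv⟩
    set X := c.origin + (v 1 • c.frame 0 + v 2 • c.frame 1 + (0 : ℝ) • c.frame 2) with hX
    have hco : ∀ i, c.coord X i = ![v 1, v 2, 0] i := by
      intro i
      rw [coord, hX, add_sub_cancel_left, real_inner_comm]
      exact c.inner_combo_frame ![v 1, v 2, 0] i
    have hhom : c.hom X = v := by
      ext i; fin_cases i <;> simp [hom, hco, hv0]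
    have hX2 : c.coord X 2 = 0 := hco 2
    refine ⟨X, ⟨hX2, by rw [hhom]; exact hvc⟩, X + k • n, ⟨?_, ?_⟩, ⟨k, by simp⟩, ?_⟩
    · rw [dist_eq_norm, add_sub_cancel_left, norm_smul, hn, mul_one, Real.norm_eq_abs, hk]
    · rintro u ⟨r, s, rfl, hrs⟩
      rw [hhom] at hrs
      rw [add_sub_cancel_left, real_inner_smul_right, ← c.dotProduct_trace_of_tangentVector r s n
        (e - k), hv _ hrs, mul_zero]
    · have h1 := hv v hvc
      rw [← hhom, c.hom_dotProduct_trace hX2] at h1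
      simp only [inner_add_right, real_inner_smul_right,
        real_inner_self_eq_norm_sq, hn] at h1 ⊢
      linarith

theorem isClosed_offsetPlanes (d : ℝ) : IsClosed (offsetPlanes d c.tangentPlanes) := by
  have h : offsetPlanes d c.tangentPlanes = {E : E3 × ℝ | ‖E.1‖ = 1} ∩
      ({E : E3 × ℝ | OnCone (c.coneTrace E.1 (E.2 - d))} ∪
        {E : E3 × ℝ | OnCone (c.coneTrace E.1 (E.2 + d))}) := by
    ext ⟨n, e⟩
    refine and_congr_right fun hn => ?_
    have hn0 : n ≠ 0 := by
      rw [← norm_ne_zero_iff]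
      exact hn.trans_ne one_ne_zero
    simp only [mem_tangentPlanes_iff]
    simp [hn0]
  rw [h]
  refine (isClosed_eq (by fun_prop) (by fun_prop)).inter (IsClosed.union ?_ ?_)
  · exact isClosed_onCone.preimage (c.continuous_coneTrace.comp
      (continuous_fst.prodMk (continuous_snd.sub continuous_const)))
  · exact isClosed_onCone.preimage (c.continuous_coneTrace.comp
      (continuous_fst.prodMk (continuous_snd.add continuous_const)))

theorem pipeDual_eq_offsetPlanes {d : ℝ} (hd : d ≠ 0) :
    c.pipeDual d = offsetPlanes d c.tangentPlanes := by
  apply Set.Subset.antisymm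
  · refine closure_minimal ?_ (c.isClosed_offsetPlanes d)
    rintro ⟨n, e⟩ h
    obtain ⟨hn, k, hk, v, hv0, hvc, hv⟩ := (c.mem_pipeTangentPlanes_iff hd n e).mp h
    refine (mem_offsetPlanes_iff d _ n e).mpr ⟨hn, k, hk, ?_, v, ?_, hvc, hv⟩
    · rw [← norm_ne_zero_iff]
      exact hn.trans_ne one_ne_zero
    · rintro rfl; simp at hv0
  · rintro ⟨n, e⟩ h
    obtain ⟨hn, k, hk, h⟩ := (mem_offsetPlanes_iff d _ n e).mp h
    have hcl := c.mem_closure_unit (E := (n, e - k))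
      (q := {E | c.infinityForm ⬝ᵥ c.coneTrace E.1 E.2 ≠ 0}) (by
        intro r E hr hE
        simp only [Set.mem_ofPred_eq, Prod.smul_fst, Prod.smul_snd, smul_eq_mul, coneTrace_smul,
          dotProduct_smul] at hE ⊢
        exact mul_ne_zero hr hE) hn
      (c.mem_closure_infinityForm_ne_zero ((c.mem_tangentPlanes_iff _ _).mp h).2)
    have hc : Continuous fun E : E3 × ℝ => (E.1, E.2 + k) := by fun_prop
    have := map_mem_closure (t := c.pipeTangentPlanes d) hc hcl (by
      rintro ⟨n', e'⟩ ⟨h1, h2, h3⟩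
      refine (c.mem_pipeTangentPlanes_iff hd _ _).mpr ⟨h1, k, hk, ?_⟩
      rw [add_sub_cancel_right]
      exact c.exists_affine_containsPolar h2 h3)
    simpa [pipeDual] using this

/-! ### Conchoids of the pedal surface -/

theorem mem_pedal_offsetPlanes_iff (d : ℝ) (x : E3) :
    x ∈ pedal (offsetPlanes d c.tangentPlanes) ↔
      ∃ n e, (n, e) ∈ offsetPlanes d c.tangentPlanes ∧ x = e • n := by
  constructor
  · rintro ⟨⟨n, e⟩, ⟨hE, -⟩, rfl⟩
    exact ⟨n, e, hE, by simp [footPoint, show ‖n‖ = 1 from hE.1]⟩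
  · rintro ⟨n, e, hE, rfl⟩
    have hn : ‖n‖ = 1 := hE.1
    refine ⟨(n, e), ⟨hE, ?_⟩, by simp [footPoint, hn]⟩
    rw [← norm_ne_zero_iff]
    exact hn.trans_ne one_ne_zero

/-- Unit normals form a compact sphere, so projecting the closed set of pairs (normal, foot) to the
foot is a closed map. -/
theorem isClosed_pedal_offsetPlanes (d : ℝ) :
    IsClosed (pedal (offsetPlanes d c.tangentPlanes)) := by
  let T : Set (Metric.sphere (0 : E3) 1 × E3) :=
    {p | ((p.1 : E3), ⟪(p.1 : E3), p.2⟫) ∈ offsetPlanes d c.tangentPlanes ∧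
      p.2 = ⟪(p.1 : E3), p.2⟫ • (p.1 : E3)}
  have hT : IsClosed T :=
    ((c.isClosed_offsetPlanes d).preimage (f := fun p : Metric.sphere (0 : E3) 1 × E3 =>
      ((p.1 : E3), ⟪(p.1 : E3), p.2⟫)) (by fun_prop)).inter
      (isClosed_eq (by fun_prop) (by fun_prop))
  have h : pedal (offsetPlanes d c.tangentPlanes) = Prod.snd '' T := by
    ext x
    rw [mem_pedal_offsetPlanes_iff]
    constructor
    · rintro ⟨n, e, hE, rfl⟩
      have hn : ‖n‖ = 1 := hE.1
      have he : ⟪n, e • n⟫ = e := by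
        rw [real_inner_smul_right, real_inner_self_eq_norm_sq, hn]; ring
      refine ⟨(⟨n, by simpa using hn⟩, e • n), ⟨?_, ?_⟩, rfl⟩
      · simpa only [he] using hE
      · simp only [he]
    · rintro ⟨⟨n, y⟩, ⟨h1, h2⟩, rfl⟩
      exact ⟨n, _, h1, h2⟩
  rw [h]
  exact isClosedMap_snd_of_compactSpace _ hT

theorem pedal_offsetPlanes_eq_conchoid (d : ℝ) :
    pedal (offsetPlanes d c.tangentPlanes) = conchoid d (pedal c.tangentPlanes) := by
  apply Set.Subset.antisymm
  · intro x hx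
    obtain ⟨n, e, hE, rfl⟩ := (c.mem_pedal_offsetPlanes_iff d x).mp hx
    obtain ⟨hn, k, hk, h⟩ := (mem_offsetPlanes_iff d _ n e).mp hE
    have hcl := c.mem_closure_unit (E := (n, e - k)) (q := {E | E.2 ≠ 0})
      (fun r E hr hE => mul_ne_zero hr hE) hn
      (c.mem_closure_snd_ne_zero ((c.mem_tangentPlanes_iff _ _).mp h).2)
    have hc : Continuous fun E : E3 × ℝ => (E.2 + k) • E.1 := by fun_prop
    have := map_mem_closure (t := {Q | ∃ P ∈ pedal c.tangentPlanes,
        P ≠ 0 ∧ Q ∈ line[ℝ, (0 : E3), P] ∧ dist Q P = |d|}) hc hcl (by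
      rintro ⟨n', e'⟩ ⟨h1, h2, h3⟩
      simp only [Set.mem_ofPred_eq] at h1 h2 h3
      have hn0 : n' ≠ 0 := by
        rw [← norm_ne_zero_iff]
        exact h1.trans_ne one_ne_zero
      refine ⟨e' • n', ⟨(n', e'), ⟨(c.mem_tangentPlanes_iff _ _).mpr ⟨hn0, h2⟩, hn0⟩, ?_⟩,
        smul_ne_zero h3 hn0, ?_, ?_⟩
      · simp [footPoint, h1]
      · refine mem_affineSpan_pair_iff_exists_lineMap_eq.mpr ⟨(e' + k) / e', ?_⟩
        rw [AffineMap.lineMap_apply_module', sub_zero, add_zero, smul_smul, div_mul_cancel₀ _ h3]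
      · rw [dist_eq_norm, ← sub_smul, add_sub_cancel_left, norm_smul, h1, mul_one,
          Real.norm_eq_abs, hk])
    simpa [conchoid] using this
  · refine closure_minimal ?_ (c.isClosed_pedal_offsetPlanes d)
    rintro Q ⟨P, hP, hP0, hQ, hd⟩
    obtain ⟨r, rfl⟩ := mem_affineSpan_pair_iff_exists_lineMap_eq.mp hQ
    rw [AffineMap.lineMap_apply_module', sub_zero, add_zero] at hd ⊢
    have hp : ‖P‖ ≠ 0 := norm_ne_zero_iff.mpr hP0
    have hn : ‖‖P‖⁻¹ • P‖ = 1 := by rw [norm_smul, norm_inv, norm_norm, inv_mul_cancel₀ hp]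
    -- Q = r P is the foot of the plane with unit normal P / ‖P‖ at signed distance r‖P‖; undoing
    -- the offset gives the plane with foot P.
    refine (c.mem_pedal_offsetPlanes_iff d _).mpr ⟨‖P‖⁻¹ • P, r * ‖P‖,
      (mem_offsetPlanes_iff d _ _ _).mpr ⟨hn, r * ‖P‖ - ‖P‖, ?_, ?_⟩, ?_⟩
    · have h1 : r • P - P = (r - 1) • P := by rw [sub_smul, one_smul]
      rw [← hd, dist_eq_norm, h1, norm_smul, Real.norm_eq_abs, ← abs_norm P, ← abs_mul, abs_norm]
      congr 1
      ring
    · rw [mem_tangentPlanes_iff, sub_sub_cancel]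
      refine ⟨smul_ne_zero (inv_ne_zero hp) hP0, ?_⟩
      have h1 : ‖P‖ = ‖P‖⁻¹ * ‖P‖ ^ 2 := by field_simp
      nth_rewrite 2 [h1]
      rw [coneTrace_smul]
      exact ((c.mem_pedal_tangentPlanes_iff P).mp hP).smul _
    · rw [smul_smul]
      congr 1
      field_simp

/-! ### Pedal surfaces that are Dupin cyclides -/

theorem coord_zero (i : Fin 3) : c.coord 0 i = -⟪c.origin, c.frame i⟫ := by
  rw [coord, zero_sub, inner_neg_right, real_inner_comm]

/-- The linear coefficient of the sphere at t is v₀ times the position vector of the conic point v.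
At infinity, v₀ = 0, it is a nonzero direction, so it vanishes only if that point is O. -/
theorem zero_mem_points_of_baseSphere_center {t : ℝ}
    (h : (circleFamily c.baseSphere t).2.1 = 0) : (0 : E3) ∈ c.points := by
  set z : Fin 3 → ℝ := coneFlip (coneRay t) with hz
  have hz0 : z ≠ 0 := coneFlip_ne_zero (coneRay_ne_zero t)
  have hzc : OnCone z := by simpa using (onCone_smul_coneRay 1 t).coneFlip
  have hzi : z = ![1, Real.cos t, Real.sin t] := by simp [hz, coneRay, coneFlip]
  have hv : ∀ i, c.shape.param.mulVec z i = c.shape.param i 0 + c.shape.param i 1 * Real.cos t +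
      c.shape.param i 2 * Real.sin t := by
    intro i
    simp [hzi, Matrix.mulVec, dotProduct, Fin.sum_univ_three]
  set v := c.shape.param.mulVec z with hvdef
  have h' : (circleFamily c.baseSphere t).2.1 =
      v 0 • c.origin + v 1 • c.frame 0 + v 2 • c.frame 1 := by
    simp only [circleFamily, baseSphere, Prod.snd_add, Prod.fst_add, Prod.smul_snd, Prod.smul_fst,
      hv]
    module
  have hi : ∀ i, v 0 * ⟪c.origin, c.frame i⟫ + ![v 1, v 2, 0] i = 0 := by
    intro i
    have h1 := congrArg (fun y : E3 => ⟪y, c.frame i⟫) (h'.symm.trans h)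
    simp only [inner_add_left, real_inner_smul_left, inner_frame, inner_zero_left] at h1
    fin_cases i <;> simpa using h1
  have h0 := hi 0
  have h1 := hi 1
  have h2 := hi 2
  simp only [Matrix.cons_val] at h0 h1 h2
  have hv0 : v 0 ≠ 0 := by
    intro hv0
    refine c.shape.param_mulVec_ne_zero hz0 ?_
    rw [← hvdef]
    ext i
    fin_cases i
    · exact hv0
    · simpa [hv0] using h0
    · simpa [hv0] using h1
  have hhom : v = v 0 • c.hom 0 := by
    ext i
    fin_cases i
    · simp [hom]
    · simp [hom, coord_zero]; linarith
    · simp [hom, coord_zero]; linarith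
  refine ⟨?_, ?_⟩
  · rw [coord_zero, neg_eq_zero]
    exact (mul_eq_zero.mp (by simpa using h2)).resolve_left hv0
  · have hc := (c.param_mulVec_onConic_iff z).mpr hzc
    rw [← hvdef, hhom, Matrix.mulVec_smul, dotProduct_smul, smul_dotProduct, smul_eq_mul,
      smul_eq_mul, mul_eq_zero, mul_eq_zero, or_iff_right hv0, or_iff_right hv0] at hc
    exact hc

/-- The spheres `R + T`, `R - T`, `2 l`, where `R` is the point sphere `O` and `l` is the plane
through `O` with normal vector `b`. They span the conic `R T = l²` of spheres. -/
def _root_.secondBase (T : ℝ × E3 × ℝ) (b : E3) : Fin 3 → ℝ × E3 × ℝ :=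
  ![(1, 0, 0) + T, (1, 0, 0) - T, (2 : ℝ) • (0, b, 0)]

theorem _root_.sphereEq_secondBase (T : ℝ × E3 × ℝ) (b x : E3) :
    (fun i => sphereEq (secondBase T b i) x) =
      ![‖x‖ ^ 2 + sphereEq T x, ‖x‖ ^ 2 - sphereEq T x, 2 * ⟪b, x⟫] := by
  ext i
  fin_cases i
  · simp [secondBase, sphereEq]; ring
  · simp [secondBase, sphereEq, inner_neg_left]; ring
  · simp [secondBase, sphereEq, real_inner_smul_left]

theorem _root_.linearIndependent_secondBase {T : ℝ × E3 × ℝ} {b : E3} (hT : T.2.2 ≠ 0)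
    (hb : b ≠ 0) : LinearIndependent ℝ (secondBase T b) := by
  rw [Fintype.linearIndependent_iff]
  intro g hg
  obtain ⟨T0, T1, T2⟩ := T
  have h1 := congrArg Prod.fst hg
  have h2 := congrArg (fun s : ℝ × E3 × ℝ => s.2.1) hg
  have h3 := congrArg (fun s : ℝ × E3 × ℝ => s.2.2) hg
  simp [Fin.sum_univ_three, secondBase] at h1 h2 h3 hT
  have e1 : g 0 = g 1 := mul_right_cancel₀ hT (by linarith)
  have e2 : g 0 = 0 := by rw [← e1] at h1; linarith
  have e3 : g 2 = 0 := by
    rw [← e1, e2] at h2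
    simpa [hb] using h2
  intro i
  fin_cases i
  · exact e2
  · exact e1.symm.trans e2
  · exact e3

theorem _root_.onCone_secondBase_iff (T : ℝ × E3 × ℝ) (b x : E3) :
    (OnCone fun i => sphereEq (secondBase T b i) x) ↔ ⟪b, x⟫ ^ 2 = ‖x‖ ^ 2 * sphereEq T x := by
  rw [sphereEq_secondBase]
  simp only [OnCone, Matrix.cons_val]
  constructor <;> intro h
  · linear_combination h / 4
  · linear_combination 4 * h

/-- The characteristic at t is cut out by l = w R, T = w² R with w = -cot(t/2). The inversion X = x
/ ‖x‖² turns these into the equations in `hX`. The reflection in the plane through O orthogonal to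
`frame 1` preserves T and l and supplies a second point. -/
theorem dense_nontrivial_characteristic_secondBase {T : ℝ × E3 × ℝ} {b : E3}
    (hT1 : ⟪T.2.1, c.frame 1⟫ = 0) (hb1 : ⟪b, c.frame 1⟫ = 0) {k g : ℝ} (hkg : ¬(k = 0 ∧ g = 0))
    (hX : ∀ w, k - g * w ≠ 0 → ∃ X, ⟪X, c.frame 1⟫ ≠ 0 ∧ ⟪b, X⟫ = w ∧
      T.1 + ⟪T.2.1, X⟫ + T.2.2 * ‖X‖ ^ 2 = w ^ 2) :
    Dense {t | (characteristic (circleFamily (secondBase T b)) t).Nontrivial} := by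
  refine (dense_trig_ne_zero (A := k) (B := -k) (C := g) (by tauto)).mono fun t ht => ?_
  simp only [Set.mem_ofPred_eq] at ht ⊢
  have hsc := Real.sin_sq_add_cos_sq t
  set C := Real.cos t with hC
  set S := Real.sin t with hS
  -- The excluded value cos t = 1 is the point sphere R itself, where w is infinite.
  have h1C : 1 - C ≠ 0 := by
    intro h
    have hS0 : S = 0 := by
      have : S ^ 2 = 0 := by linear_combination hsc + (1 + C) * h
      exact pow_eq_zero_iff two_ne_zero |>.mp this
    apply ht
    linear_combination k * h + g * hS0
  obtain ⟨X, hX1, hXb, hXT⟩ := hX (-S / (1 - C)) (by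
    have : k - g * (-S / (1 - C)) = (k + -k * C + g * S) / (1 - C) := by field_simp; ring
    rw [this]
    exact div_ne_zero ht h1C)
  have hX0 : ‖X‖ ≠ 0 := by
    rw [norm_ne_zero_iff]
    rintro rfl
    simp at hX1
  obtain ⟨x, hx⟩ : ∃ x : E3, x = (‖X‖ ^ 2)⁻¹ • X := ⟨_, rfl⟩
  have hxn : ‖x‖ ^ 2 = (‖X‖ ^ 2)⁻¹ := by
    rw [hx, norm_smul, norm_inv, norm_pow, norm_norm]
    field_simp
  have hxT : sphereEq T x = (-S / (1 - C)) ^ 2 * (‖X‖ ^ 2)⁻¹ := by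
    rw [sphereEq, hxn, hx, real_inner_smul_right, ← hXT]
    field_simp
  have hxb : ⟪b, x⟫ = -S / (1 - C) * (‖X‖ ^ 2)⁻¹ := by
    rw [hx, real_inner_smul_right, hXb, mul_comm]
  have hx1 : ⟪x, c.frame 1⟫ ≠ 0 := by
    rw [hx, real_inner_smul_left]
    exact mul_ne_zero (inv_ne_zero (pow_ne_zero _ hX0)) hX1
  have hmem : x ∈ characteristic (circleFamily (secondBase T b)) t := by
    rw [mem_characteristic_circleFamily, sphereEq_secondBase, hxn, hxT, hxb]
    refine ⟨-2 / (1 - C) * (‖X‖ ^ 2)⁻¹, ?_⟩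
    have hw : (-S / (1 - C)) ^ 2 = (1 + C) / (1 - C) := by
      field_simp
      linear_combination hsc
    rw [hw]
    ext i
    fin_cases i <;> simp [coneRay, ← hC, ← hS] <;> field_simp <;> ring
  obtain ⟨y, hy⟩ : ∃ y : E3, y = x - (2 * ⟪x, c.frame 1⟫) • c.frame 1 := ⟨_, rfl⟩
  have h11 : ‖c.frame 1‖ = 1 := c.frame.orthonormal.1 1
  have hyn : ‖y‖ ^ 2 = ‖x‖ ^ 2 := by
    rw [hy, norm_sub_sq_real, norm_smul, real_inner_smul_right, h11, Real.norm_eq_abs, mul_one,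
      sq_abs]
    ring
  have hyT : sphereEq T y = sphereEq T x := by
    rw [sphereEq, sphereEq, hyn, hy, inner_sub_right, real_inner_smul_right, hT1, mul_zero,
      sub_zero]
  have hyb : ⟪b, y⟫ = ⟪b, x⟫ := by
    rw [hy, inner_sub_right, real_inner_smul_right, hb1, mul_zero, sub_zero]
  refine ⟨x, hmem, y, ?_, ?_⟩
  · rw [mem_characteristic_circleFamily, sphereEq_secondBase] at hmem ⊢
    rwa [hyn, hyT, hyb]
  · intro hxy
    rw [hy, eq_comm, sub_eq_self] at hxy
    refine smul_ne_zero (mul_ne_zero two_ne_zero hx1) ?_ hxy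
    rw [← norm_ne_zero_iff, h11]
    exact one_ne_zero

/-- If the equation of the pedal surface has the form `l² = R T`, it is a Dupin cyclide. -/
theorem isDupinCyclide_pedal_of_factorization {T : ℝ × E3 × ℝ} {b : E3} (hT : T.2.2 ≠ 0)
    (hb : b ≠ 0) (hT1 : ⟪T.2.1, c.frame 1⟫ = 0) (hb1 : ⟪b, c.frame 1⟫ = 0)
    (hG : ∀ x, OnCone (c.coneTrace x (‖x‖ ^ 2)) ↔ ⟪b, x⟫ ^ 2 = ‖x‖ ^ 2 * sphereEq T x)
    {k g : ℝ} (hkg : ¬(k = 0 ∧ g = 0))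
    (hX : ∀ w, k - g * w ≠ 0 → ∃ X, ⟪X, c.frame 1⟫ ≠ 0 ∧ ⟪b, X⟫ = w ∧
      T.1 + ⟪T.2.1, X⟫ + T.2.2 * ‖X‖ ^ 2 = w ^ 2)
    (h0 : (0 : E3) ∉ c.points) : IsDupinCyclide (pedal c.tangentPlanes) := by
  refine ⟨circleFamily c.baseSphere, circleFamily (secondBase T b), c.isSphereEnvelope_pedal,
    isSphereEnvelope_circleFamily (linearIndependent_secondBase hT hb) ?_
      (c.dense_nontrivial_characteristic_secondBase hT1 hb1 hkg hX), fun t u => ?_⟩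
  · ext x
    rw [mem_pedal_tangentPlanes_iff, hG, Set.mem_ofPred_eq, onCone_secondBase_iff]
  · have hs1 : (circleFamily c.baseSphere t).2.1 ≠ 0 :=
      fun h => h0 (c.zero_mem_points_of_baseSphere_center h)
    have hs2 : (circleFamily c.baseSphere t).2.2 = 0 := by simp [circleFamily, baseSphere]
    rw [LinearIndependent.pair_iff]
    intro r s hrs
    have h2 := congrArg (fun s : ℝ × E3 × ℝ => s.2.1) hrs
    have h3 := congrArg (fun s : ℝ × E3 × ℝ => s.2.2) hrs
    have h1 := congrArg Prod.fst hrs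
    simp only [Prod.snd_add, Prod.fst_add, Prod.smul_snd, Prod.smul_fst, hs2, smul_eq_mul,
      mul_zero, zero_add, Prod.snd_zero, Prod.fst_zero] at h1 h2 h3
    have h3' : (circleFamily (secondBase T b) u).2.2 = (1 - Real.cos u) * T.2.2 := by
      simp [circleFamily, secondBase]; ring
    rw [h3'] at h3
    -- Every sphere of the first family passes through O. In the second only the point sphere R
    -- does, and a first-family sphere has a nonzero linear coefficient because O is not on the
    -- conic.
    rcases mul_eq_zero.mp h3 with rfl | h3
    · rw [zero_smul, add_zero] at h2
      exact ⟨(smul_eq_zero.mp h2).resolve_right hs1, rfl⟩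
    · have hc : Real.cos u = 1 := by linarith [(mul_eq_zero.mp h3).resolve_right hT]
      have hs : Real.sin u = 0 := by
        have := Real.sin_sq_add_cos_sq u
        rw [hc] at this
        exact pow_eq_zero_iff two_ne_zero |>.mp (by linarith)
      have h4 : circleFamily (secondBase T b) u = (2, 0, 0) := by
        obtain ⟨T0, T1, T2⟩ := T
        simp [circleFamily, secondBase, hc, hs]
        norm_num
      rw [h4] at h1 h2
      rw [smul_zero, add_zero] at h2
      have hr := (smul_eq_zero.mp h2).resolve_right hs1
      subst hr
      exact ⟨rfl, by simpa using h1⟩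

theorem norm_sq_eq_frame (x : E3) :
    ‖x‖ ^ 2 = ⟪x, c.frame 0⟫ ^ 2 + ⟪x, c.frame 1⟫ ^ 2 + ⟪x, c.frame 2⟫ ^ 2 := by
  rw [← real_inner_self_eq_norm_sq, c.inner_eq_frame]
  ring

/-- A point with prescribed coordinates with respect to the frame. -/
theorem exists_inner_frame_eq (r : Fin 3 → ℝ) : ∃ X : E3, ∀ i, ⟪X, c.frame i⟫ = r i :=
  ⟨_, c.inner_combo_frame r⟩

theorem coneTrace_ellipse {a b : ℝ} {hb : 0 < b} {hab : b ≤ a}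
    (hq : c.shape = .ellipse a b hb hab) (n : E3) (e : ℝ) :
    c.coneTrace n e = ![⟪n, c.origin⟫ - e, a * ⟪n, c.frame 0⟫, b * ⟪n, c.frame 1⟫] := by
  ext i
  fin_cases i <;> simp [coneTrace, hq, ConicShape.param, trace, Matrix.mulVec, dotProduct,
    Fin.sum_univ_three]

theorem coneTrace_hyperbola {a b : ℝ} {ha : 0 < a} {hb : 0 < b}
    (hq : c.shape = .hyperbola a b ha hb) (n : E3) (e : ℝ) :
    c.coneTrace n e = ![a * ⟪n, c.frame 0⟫, ⟪n, c.origin⟫ - e, b * ⟪n, c.frame 1⟫] := by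
  ext i
  fin_cases i <;> simp [coneTrace, hq, ConicShape.param, trace, Matrix.mulVec, dotProduct,
    Fin.sum_univ_three]

theorem coneTrace_parabola {p : ℝ} {hp : 0 < p}
    (hq : c.shape = .parabola p hp) (n : E3) (e : ℝ) :
    c.coneTrace n e = ![⟪n, c.origin⟫ - e + 1 / (2 * p) * ⟪n, c.frame 0⟫,
      ⟪n, c.origin⟫ - e - 1 / (2 * p) * ⟪n, c.frame 0⟫, ⟪n, c.frame 1⟫] := by
  ext i
  fin_cases i <;> simp [coneTrace, hq, ConicShape.param, trace, Matrix.mulVec, dotProduct,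
    Fin.sum_univ_three]
  ring

/-- Substituting x₁² = R - x₀² - x₂² gives R(-R + 2⟪o, x⟫ + b²) = (o₀² - a² + b²)x₀² + 2o₀o₂x₀x₂ +
(b² + o₂²)x₂². The focal conic equation makes the right side the square of l = m x₀ + k x₂. -/
theorem isDupinCyclide_pedal_of_ellipse {a b : ℝ} {hb : 0 < b} {hab : b ≤ a}
    (hq : c.shape = .ellipse a b hb hab) (h : (0 : E3) ∈ c.focalConic) :
    IsDupinCyclide (pedal c.tangentPlanes) := by
  obtain ⟨h1, h2⟩ := h
  simp only [hq, coord_zero] at h1 h2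
  have ha : 0 < a := hb.trans_le hab
  have ho1 : ⟪c.origin, c.frame 1⟫ = 0 := by linarith
  set k := Real.sqrt (b ^ 2 + ⟪c.origin, c.frame 2⟫ ^ 2) with hk
  have hk2 : k ^ 2 = b ^ 2 + ⟪c.origin, c.frame 2⟫ ^ 2 := Real.sq_sqrt (by positivity)
  have hk0 : 0 < k := Real.sqrt_pos.mpr (by positivity)
  obtain ⟨m, hm⟩ : ∃ m, m * k = ⟪c.origin, c.frame 0⟫ * ⟪c.origin, c.frame 2⟫ :=
    ⟨_, div_mul_cancel₀ _ hk0.ne'⟩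
  have hm2 : m ^ 2 = ⟪c.origin, c.frame 0⟫ ^ 2 - (a ^ 2 - b ^ 2) := by
    have : k ^ 2 ≠ 0 := by positivity
    apply mul_right_cancel₀ this
    rw [← mul_pow, hm, hk2]
    linear_combination -h2
  obtain ⟨l, hl⟩ := c.exists_inner_frame_eq ![m, 0, k]
  have hl0 := hl 0
  have hl1 := hl 1
  have hl2 := hl 2
  simp only [Matrix.cons_val] at hl0 hl1 hl2
  refine c.isDupinCyclide_pedal_of_factorization (T := (-1, (2 : ℝ) • c.origin, b ^ 2)) (b := l)
    (k := k) (g := ⟪c.origin, c.frame 2⟫) (by positivity) ?_ ?_ hl1 (fun x => ?_)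
    (fun h => hk0.ne' h.1) (fun w hw => ?_) ?_
  · rintro rfl
    rw [inner_zero_left] at hl2
    exact hk0.ne hl2
  · rw [real_inner_smul_left, ho1, mul_zero]
  · have hR := c.norm_sq_eq_frame x
    rw [c.coneTrace_ellipse hq]
    simp only [OnCone, Matrix.cons_val, sphereEq, real_inner_smul_left, c.inner_eq_frame l x,
      c.inner_eq_frame c.origin x, c.inner_eq_frame x c.origin, hl0, hl1, hl2, ho1]
    constructor
    · intro h3
      linear_combination hm2 * ⟪x, c.frame 0⟫ ^ 2 + hk2 * ⟪x, c.frame 2⟫ ^ 2 +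
        2 * ⟪x, c.frame 0⟫ * ⟪x, c.frame 2⟫ * hm - b ^ 2 * hR - h3
    · intro h3
      linear_combination hm2 * ⟪x, c.frame 0⟫ ^ 2 + hk2 * ⟪x, c.frame 2⟫ ^ 2 +
        2 * ⟪x, c.frame 0⟫ * ⟪x, c.frame 2⟫ * hm - b ^ 2 * hR - h3
  -- With X₀ = 0 the plane equation fixes X₂ = w / k, and the remaining equation becomes (b X₁)² =
  -- (1 - o₂w/k)².
  · obtain ⟨X, hX⟩ := c.exists_inner_frame_eq
      ![0, (1 - ⟪c.origin, c.frame 2⟫ * w / k) / b, w / k]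
    have hX0 := hX 0
    have hX1 := hX 1
    have hX2 := hX 2
    simp only [Matrix.cons_val] at hX0 hX1 hX2
    refine ⟨X, ?_, ?_, ?_⟩
    · rw [hX1]
      refine div_ne_zero ?_ hb.ne'
      have : 1 - ⟪c.origin, c.frame 2⟫ * w / k = (k - ⟪c.origin, c.frame 2⟫ * w) / k := by
        field_simp
      rw [this]
      exact div_ne_zero hw hk0.ne'
    · rw [c.inner_eq_frame, hX0, hX1, hX2, hl0, hl1, hl2]
      field_simp
      ring
    · simp only [real_inner_smul_left, c.inner_eq_frame c.origin X, c.norm_sq_eq_frame X, hX0, hX1,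
        hX2, ho1]
      field_simp
      linear_combination -b * w ^ 2 * hk2
  -- The focal conic meets the carrier plane in foci only, and these are not on the conic.
  · rintro ⟨h3, h4⟩
    rw [coord_zero, neg_eq_zero] at h3
    rw [h3] at h2
    simp [hq, hom, coord_zero, ho1, ConicShape.matrix, dotProduct, Fin.sum_univ_three] at h4
    field_simp at h4
    have : b ^ 2 * b ^ 2 = 0 := by linear_combination h2 - b ^ 2 * h4
    exact absurd this (by positivity)

/-- The angle φ parametrizes the focal ellipse by o₀ = r cos φ, o₂ = b sin φ. Then r²x₀² + b²x₂² -
(o₀x₀ + o₂x₂)² is the square of l by Lagrange's identity. -/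
theorem isDupinCyclide_pedal_of_hyperbola {a b : ℝ} {ha : 0 < a} {hb : 0 < b}
    (hq : c.shape = .hyperbola a b ha hb) (h : (0 : E3) ∈ c.focalConic) :
    IsDupinCyclide (pedal c.tangentPlanes) := by
  obtain ⟨h1, h2⟩ := h
  simp only [hq, coord_zero] at h1 h2
  have ho1 : ⟪c.origin, c.frame 1⟫ = 0 := by linarith
  set r := Real.sqrt (a ^ 2 + b ^ 2) with hr
  have hr2 : r ^ 2 = a ^ 2 + b ^ 2 := Real.sq_sqrt (by positivity)
  have hr0 : 0 < r := Real.sqrt_pos.mpr (by positivity)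
  obtain ⟨φ, hC, hS⟩ := exists_cos_sin (x := ⟪c.origin, c.frame 0⟫ / r)
    (y := ⟪c.origin, c.frame 2⟫ / b) (by rw [div_pow, div_pow, hr2]; simpa using h2)
  have hsc := Real.sin_sq_add_cos_sq φ
  set C := Real.cos φ
  set S := Real.sin φ
  rw [div_eq_iff hr0.ne'] at hC
  rw [div_eq_iff hb.ne'] at hS
  have hCS : ¬(C = 0 ∧ S = 0) := by
    rintro ⟨hC0, hS0⟩
    rw [hC0, hS0] at hsc
    norm_num at hsc
  obtain ⟨l, hl⟩ := c.exists_inner_frame_eq ![-(r * S), 0, b * C]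
  have hl0 := hl 0
  have hl1 := hl 1
  have hl2 := hl 2
  simp only [Matrix.cons_val] at hl0 hl1 hl2
  refine c.isDupinCyclide_pedal_of_factorization (T := (1, (-2 : ℝ) • c.origin, b ^ 2)) (b := l)
    (k := C) (g := S) (by positivity) ?_ ?_ hl1 (fun x => ?_) hCS (fun w hw => ?_) ?_
  · rintro rfl
    rw [inner_zero_left] at hl0 hl2
    refine hCS ⟨?_, ?_⟩
    · exact (mul_eq_zero.mp hl2.symm).resolve_left hb.ne'
    · exact (mul_eq_zero.mp (neg_eq_zero.mp hl0.symm)).resolve_left hr0.ne'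
  · rw [real_inner_smul_left, ho1, mul_zero]
  · have hR := c.norm_sq_eq_frame x
    rw [c.coneTrace_hyperbola hq]
    simp only [OnCone, Matrix.cons_val, sphereEq, real_inner_smul_left, c.inner_eq_frame l x,
      c.inner_eq_frame c.origin x, c.inner_eq_frame x c.origin, hl0, hl1, hl2, ho1, hC, hS]
    generalize ⟪x, c.frame 0⟫ = x0 at *
    generalize ⟪x, c.frame 1⟫ = x1 at *
    generalize ⟪x, c.frame 2⟫ = x2 at *
    have key : (-(r * S) * x0 + 0 * x1 + b * C * x2) ^ 2 - ‖x‖ ^ 2 * (1 * ‖x‖ ^ 2 +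
        -2 * (C * r * x0 + 0 * x1 + S * b * x2) + b ^ 2) = a ^ 2 * x0 ^ 2 - b ^ 2 * x1 ^ 2 -
        (x0 * (C * r) + x1 * 0 + x2 * (S * b) - ‖x‖ ^ 2) ^ 2 := by
      linear_combination (r ^ 2 * x0 ^ 2 + b ^ 2 * x2 ^ 2) * hsc + x0 ^ 2 * hr2 - b ^ 2 * hR
    constructor
    · intro h3
      linear_combination key - h3
    · intro h3
      linear_combination key - h3
  -- The vector (r X₀, b X₂) is (C, S) + w(-S, C) in the rotated orthonormal basis. The ratio X₁ :
  -- X₀ = a : b gives b²(X₀² + X₁²) = (r X₀)².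
  · obtain ⟨X, hX⟩ := c.exists_inner_frame_eq
      ![(C - S * w) / r, a * ((C - S * w) / r) / b, (w * C + S) / b]
    have hX0 := hX 0
    have hX1 := hX 1
    have hX2 := hX 2
    simp only [Matrix.cons_val] at hX0 hX1 hX2
    refine ⟨X, ?_, ?_, ?_⟩
    · rw [hX1]
      exact div_ne_zero (mul_ne_zero ha.ne' (div_ne_zero hw hr0.ne')) hb.ne'
    · rw [c.inner_eq_frame, hX0, hX1, hX2, hl0, hl1, hl2]
      field_simp
      linear_combination w * r * b * hsc
    · simp only [real_inner_smul_left, c.inner_eq_frame c.origin X, c.norm_sq_eq_frame X, hX0, hX1,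
        hX2, ho1, hC, hS]
      field_simp
      linear_combination b * r ^ 2 * (w ^ 2 - 1) * hsc - b * (C - S * w) ^ 2 * hr2
  · rintro ⟨h3, h4⟩
    rw [coord_zero, neg_eq_zero] at h3
    rw [h3] at h2
    simp [hq, hom, coord_zero, ho1, ConicShape.matrix, dotProduct, Fin.sum_univ_three] at h4
    field_simp at h4 h2
    have : b ^ 2 * b ^ 2 = 0 := by linear_combination b ^ 2 * h4 - h2
    exact absurd this (by positivity)

/-- Here T is a plane: the equation becomes R(1 + 2x₀/p) = (1 + 2o₀/p)x₀² + 2(o₂/p)x₀x₂ + x₂², and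
the focal parabola says 1 + 2o₀/p = (o₂/p)². -/
theorem isDupinCyclide_pedal_of_parabola {p : ℝ} {hp : 0 < p}
    (hq : c.shape = .parabola p hp) (h : (0 : E3) ∈ c.focalConic) :
    IsDupinCyclide (pedal c.tangentPlanes) := by
  obtain ⟨h1, h2⟩ := h
  simp only [hq, coord_zero] at h1 h2
  have ho1 : ⟪c.origin, c.frame 1⟫ = 0 := by linarith
  set o0 := ⟪c.origin, c.frame 0⟫ with ho0
  set o2 := ⟪c.origin, c.frame 2⟫ with ho2
  have h2' : o2 ^ 2 = p * (2 * o0 + p) := by linear_combination h2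
  have hop : 0 < o0 + p := by nlinarith [sq_nonneg o2]
  obtain ⟨l, hl⟩ := c.exists_inner_frame_eq ![o2 / p, 0, 1]
  have hl0 := hl 0
  have hl1 := hl 1
  have hl2 := hl 2
  simp only [Matrix.cons_val] at hl0 hl1 hl2
  have f0 : ⟪c.frame 0, c.frame 0⟫ = 1 := by rw [inner_frame]; simp
  have f1 : ⟪c.frame 0, c.frame 1⟫ = 0 := by rw [inner_frame]; simp
  refine c.isDupinCyclide_pedal_of_factorization (T := (0, (2 / p : ℝ) • c.frame 0, 1)) (b := l)
    (k := 1) (g := o2) one_ne_zero ?_ ?_ hl1 (fun x => ?_) (fun h => one_ne_zero h.1)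
    (fun w hw => ?_) ?_
  · rintro rfl
    rw [inner_zero_left] at hl2
    exact zero_ne_one hl2
  · rw [real_inner_smul_left, f1, mul_zero]
  · have hR := c.norm_sq_eq_frame x
    rw [c.coneTrace_parabola hq]
    simp only [OnCone, Matrix.cons_val, sphereEq, real_inner_smul_left, c.inner_eq_frame l x,
      real_inner_comm x (c.frame 0), c.inner_eq_frame x c.origin, hl0, hl1, hl2, ho1, ← ho0, ← ho2]
    generalize ⟪x, c.frame 0⟫ = x0 at *
    generalize ⟪x, c.frame 1⟫ = x1 at *
    generalize ⟪x, c.frame 2⟫ = x2 at *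
    field_simp
    constructor
    · intro h3
      linear_combination x0 ^ 2 * h2' - p ^ 2 * hR - h3 / 4
    · intro h3
      linear_combination 4 * x0 ^ 2 * h2' - 4 * p ^ 2 * hR - 4 * h3
  -- After elimination of X₂, the equation gives X₁² as a concave quadratic in X₀. The chosen X₀ is
  -- its maximum, where X₁² = (1 - o₂w)² y².
  · set y := Real.sqrt (1 / (2 * p * (o0 + p))) with hy
    have hy2 : y ^ 2 = 1 / (2 * p * (o0 + p)) := Real.sq_sqrt (by positivity)
    have hy0 : 0 < y := Real.sqrt_pos.mpr (by positivity)
    obtain ⟨X, hX⟩ := c.exists_inner_frame_eq ![-(1 - o2 * w) / (2 * (o0 + p)), (1 - o2 * w) * y,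
      w + o2 / p * ((1 - o2 * w) / (2 * (o0 + p)))]
    have hX0 := hX 0
    have hX1 := hX 1
    have hX2 := hX 2
    simp only [Matrix.cons_val] at hX0 hX1 hX2
    refine ⟨X, ?_, ?_, ?_⟩
    · rw [hX1]
      exact mul_ne_zero hw hy0.ne'
    · rw [c.inner_eq_frame, hX0, hX1, hX2, hl0, hl1, hl2]
      field_simp
      ring
    · simp only [real_inner_smul_left, real_inner_comm X (c.frame 0), c.norm_sq_eq_frame X, hX0,
        hX1, hX2, mul_pow, hy2]
      field_simp
      linear_combination (1 - o2 * w) ^ 2 * h2'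
  · rintro ⟨h3, h4⟩
    rw [coord_zero, neg_eq_zero] at h3
    rw [← ho2] at h3
    rw [h3] at h2
    simp [hq, hom, coord_zero, ho1, ConicShape.matrix, dotProduct, Fin.sum_univ_three, ← ho0] at h4
    have ho : o0 = 0 := h4.resolve_right hp.ne'
    rw [ho] at h2
    exact absurd h2 (by nlinarith)

theorem isDupinCyclide_pedal (h : (0 : E3) ∈ c.focalConic) :
    IsDupinCyclide (pedal c.tangentPlanes) := by
  cases hq : c.shape with
  | ellipse a b hb hab => exact c.isDupinCyclide_pedal_of_ellipse hq h
  | hyperbola a b ha hb => exact c.isDupinCyclide_pedal_of_hyperbola hq h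
  | parabola p hp => exact c.isDupinCyclide_pedal_of_parabola hq h

end Conic

end

theorem mainTheorem7 (c : Conic) :
    -- the conic, as the set of its tangent planes, is a singular dual quadric
    (∃ A : Matrix (Fin 4) (Fin 4) ℝ, A.IsSymm ∧ A.rank = 3 ∧
      ∀ (n : E3) (e : ℝ), n ≠ 0 → ((n, e) ∈ c.tangentPlanes ↔
        ![-e, n 0, n 1, n 2] ⬝ᵥ A.mulVec ![-e, n 0, n 1, n 2] = 0)) ∧
    -- its pedal surface is a Darboux cyclide and a canal surface
    IsDarbouxCyclide (pedal c.tangentPlanes) ∧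
    IsCanalSurface (pedal c.tangentPlanes) ∧
    -- its offsets are the pipe surfaces, whose pedal surfaces are conchoids of that cyclide
    (∀ d : ℝ, d ≠ 0 →
      c.pipeDual d = offsetPlanes d c.tangentPlanes ∧
      pedal (c.pipeDual d) = conchoid d (pedal c.tangentPlanes)) ∧
    -- if `O` lies on the focal conic, the pedal surface is a Dupin cyclide
    ((0 : E3) ∈ c.focalConic → IsDupinCyclide (pedal c.tangentPlanes)) := by
  exact ⟨⟨c.dualMatrix, c.dualMatrix_isSymm, c.dualMatrix_rank,
      fun n e hn => c.mem_tangentPlanes_iff_dualMatrix hn e⟩,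
    c.isDarbouxCyclide_pedal, ⟨_, c.isSphereEnvelope_pedal⟩,
    fun d hd => ⟨c.pipeDual_eq_offsetPlanes hd, by
      rw [c.pipeDual_eq_offsetPlanes hd, c.pedal_offsetPlanes_eq_conchoid]⟩,
    c.isDupinCyclide_pedal⟩
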